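/- **Setting.** Let $P_{Y|X_1,\dots,X_K}$ be a discrete memoryless channel with $K$ users, finite input alphabets $\mathcal X_1,\dots,\mathcal X_K$ and finite output alphabet $\mathcal Y$, and let $R_{\max}>0$. For codeword length $N$, each user $k$ has the macro messages $W_k\in\{1,\dots,\lfloor e^{NR_{\max}}\rfloor\}$, with standard rate $r(W_k)=\frac1N\log W_k$. User $k$ draws, independently of the other users, a codebook $\mathcal C_{\theta_k}$, $\theta_k\sim\gamma_k^{(N)}$, from a library $\mathcal L_k^{(N)}$, such that all codeword symbols $\mathcal C_{\theta_k}(W)_j$ (over all $W$ and $1\le j\le N$) are independent and $\mathcal C_{\theta_k}(W)_j$ has distribution $P^{(N)}_{X_k|W}$ (a generalized random coding scheme). For every user $k$ let $P_{X_k|r_k}$, $r_k\in[0,R_{\max}]$, be distributions on $\mathcal X_k$. The schemes follow this asymptotic input distribution: for each $k$ and each message sequence $W^{(N)}$ for which $\lim_N r(W^{(N)})$ exists, $P^{(N)}_{X_k|W^{(N)}}-P_{X_k|r(W^{(N)})}\to0$. Assume that $r_k\mapsto P_{X_k|r_k}$ is discontinuous at only finitely many points, for each $k$. Let $\mathcal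 R\subseteq[0,R_{\max}]^K$ be an operation region (in particular, it may be any region strictly contained in an achievable rate region). A decoder knows all codebooks and the channel output and outputs either a message vector $\mathbf W$ with $\mathbf r(\mathbf W)\in\mathcal R$ or "collision". Its system error probability $P_{es}$ is the larger of the maximal probability, over message vectors $\mathbf W$ with $\mathbf r(\mathbf W)\in\mathcal R$, of not outputting $\mathbf W$ when $\mathbf W$ is sent, and the maximal probability, over message vectors with $\mathbf r(\mathbf W)\notin\mathcal R$, of not reporting a collision when $\mathbf W$ is sent; probabilities are over the codebooks and the channel. The system error exponent of a sequence of decoders is $E_s=\liminf_{N\to\infty}-\frac1N\log P_{es}$. **Theorem.** There is a sequence of decoders with $$E_s\ \ge\ \min\Big\{\inf_{S\subsetneq\{1,\dots,K\}}\ \inf_{\mathbf r,\tilde{\mathbf r}\in\mathcal R,\ \mathbf r_S=\tilde{\mathbf r}_S}E_m(S,\tilde{\mathbf r},\mathbf P_{\mathbf X|\mathbf r},\mathbf P_{\mathbf X|\tilde{\mathbf r}}),\ \inf_{S\subsetneq\{1,\dots,K\}}\ \inf_{\mathbf r\in\mathcal R,\ \tilde{\mathbf r}\in[0,R_{\max}]^K\setminus\mathcal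 R,\ \mathbf r_S=\tilde{\mathbf r}_S}E_i(S,\mathbf r,\mathbf P_{\mathbf X|\mathbf r},\mathbf P_{\mathbf X|\tilde{\mathbf r}})\Big\},$$ where $$E_m=\sup_{0<\rho\le1}\Big[-\rho\sum_{k\notin S}\tilde r_k+\sup_{0<s\le1}-\log\sum_{Y}\sum_{\mathbf X_S}\prod_{k\in S}P_{X|r_k}(X_k)\Big(\sum_{\mathbf X_{\bar S}}\prod_{k\notin S}P_{X|r_k}(X_k)P(Y|\mathbf X)^{1-s}\Big)\Big(\sum_{\mathbf X_{\bar S}}\prod_{k\notin S}P_{X|\tilde r_k}(X_k)P(Y|\mathbf X)^{s/\rho}\Big)^{\rho}\Big],$$ $$E_i=\sup_{0<\rho\le1}\Big[-\rho\sum_{k\notin S}r_k+\sup_{0<s\le1-\rho}-\log\sum_{Y}\sum_{\mathbf X_S}\prod_{k\in S}P_{X|r_k}(X_k)\Big(\sum_{\mathbf X_{\bar S}}\prod_{k\notin S}P_{X|r_k}(X_k)P(Y|\mathbf X)^{\frac{s}{s+\rho}}\Big)^{s+\rho}\Big(\sum_{\mathbf X_{\bar S}}\prod_{k\notin S}P_{X|\tilde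 r_k}(X_k)P(Y|\mathbf X)\Big)^{1-s}\Big].$$ Exponents are extended real numbers: $-\log0=+\infty$, an infimum over the empty set is $+\infty$, a supremum over the empty set is $-\infty$, and $0^0=1$. -/

import Mathlib

open Filter Topology MeasureTheory ProbabilityTheory

universe u v w

noncomputable section

namespace RandomAccess

/-- Macro messages `W ∈ {1, …, ⌊e^{N R}⌋}` of a user, for codeword length `N` and maximal rate
`R`. -/
abbrev Message (N : ℕ) (R : ℝ) : Type :=
  {W : ℕ // W ∈ Finset.Icc 1 ⌊Real.exp (N * R)⌋₊}

/-- Standard communication rate `r(W) = (1/N) log W` in nats per symbol. -/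
def rate {N : ℕ} {R : ℝ} (W : Message N R) : ℝ := (1 / (N : ℝ)) * Real.log (W.1 : ℝ)

/-- A codebook: one codeword of length `N` for each macro message. -/
abbrev Codebook (𝒳 : Type v) (N : ℕ) (R : ℝ) : Type v := Message N R → Fin N → 𝒳

/-- A generalized random coding scheme of codeword length `N`: a library of codebooks indexed by
`Θ`, a distribution `γ` of the index, and input distributions `P_{X|W}` such that the codeword
symbols `X_{W,j} : θ ↦ C_θ(W)_j` are independent (over all `W` and `j`), the symbol `X_{W,j}`
having distribution `P_{X|W}`. -/
structure CodingScheme (𝒳 : Type v) [Fintype 𝒳] [MeasurableSpace 𝒳] (N : ℕ) (R : ℝ) where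
  /-- index set of the library -/
  Θ : Type u
  /-- events of the index set -/
  measurableSpace : MeasurableSpace Θ
  /-- distribution of the index -/
  γ : Measure Θ
  isProbabilityMeasure : IsProbabilityMeasure γ
  /-- the library -/
  book : Θ → Codebook 𝒳 N R
  measurable_book : ∀ W j, Measurable fun θ => book θ W j
  /-- the input distributions `P_{X|W}` -/
  inputDist : Message N R → 𝒳 → ℝ
  inputDist_mem : ∀ W, inputDist W ∈ stdSimplex ℝ 𝒳
  law : ∀ W j x, γ.real {θ | book θ W j = x} = inputDist W x
  indep : iIndepFun (fun (p : Message N R × Fin N) (θ : Θ) => book θ p.1 p.2) γ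

attribute [instance] CodingScheme.measurableSpace CodingScheme.isProbabilityMeasure

/-- A sequence of coding schemes follows the asymptotic input distribution `P_{X|r}` if
`P^{(N)}_{X|W^{(N)}}` and `P_{X|r(W^{(N)})}` agree in the limit, for all message sequences
`W^{(N)}` whose rates converge. -/
def FollowsAsymptotic {𝒳 : Type v} [Fintype 𝒳] [MeasurableSpace 𝒳] {R : ℝ}
    (𝓛 : ∀ N : ℕ, CodingScheme.{u} 𝒳 N R) (P : ℝ → 𝒳 → ℝ) : Prop :=
  ∀ W : ∀ N : ℕ, Message N R, ∀ r₀ : ℝ,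
    Tendsto (fun N => rate (W N)) atTop (𝓝 r₀) →
      Tendsto (fun N => (𝓛 N).inputDist (W N) - P (rate (W N))) atTop (𝓝 0)

section MultiUser

variable {K : ℕ} {𝒳 : Fin K → Type v} {𝒴 : Type w}

/-- The set `[0, R]^K` of rate vectors. -/
def rateBox (K : ℕ) (R : ℝ) : Set (Fin K → ℝ) := {r | ∀ k, r k ∈ Set.Icc 0 R}

/-- The rate vector of a message vector. -/
def rateVec {N : ℕ} {R : ℝ} (W : Fin K → Message N R) : Fin K → ℝ := fun k => rate (W k)

/-- A decoder: knowing the codebooks of all users and the channel output, it either outputs a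
message vector or reports a collision (`none`). -/
abbrev Decoder (𝒳 : Fin K → Type v) (𝒴 : Type w) (N : ℕ) (R : ℝ) : Type (max v w) :=
  (∀ k, Codebook (𝒳 k) N R) → (Fin N → 𝒴) → Option (Fin K → Message N R)

/-- The decoder only outputs message vectors with rates in the operation region. -/
def Decoder.OutputsIn {N : ℕ} {R : ℝ} (D : Decoder 𝒳 𝒴 N R) (ℛ : Set (Fin K → ℝ)) : Prop :=
  ∀ c y W, D c y = some W → rateVec W ∈ ℛ

variable [∀ k, Fintype (𝒳 k)] [∀ k, MeasurableSpace (𝒳 k)] [Fintype 𝒴] {N : ℕ} {R : ℝ}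

open Classical in
/-- Probability that the pair (codebooks, channel output) satisfies `A`, given that the message
vector `W` is sent: the codebooks are drawn independently by the users, then the codewords are
sent over the memoryless channel `ch`, where `ch x y` is the probability of output `y` on
input `x`. -/
def probGiven (𝓛 : ∀ k, CodingScheme.{u} (𝒳 k) N R) (ch : (∀ k, 𝒳 k) → 𝒴 → ℝ)
    (W : Fin K → Message N R)
    (A : (∀ k, Codebook (𝒳 k) N R) → (Fin N → 𝒴) → Prop) : ℝ :=
  ∫ θ, ∑ y : Fin N → 𝒴, (if A (fun k => (𝓛 k).book (θ k)) y then
    ∏ j, ch (fun k => (𝓛 k).book (θ k) (W k) j) (y j) else 0)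
    ∂(Measure.pi fun k => (𝓛 k).γ)

/-- Decoding error probability `P_e`. -/
def decodingErrorProb (𝓛 : ∀ k, CodingScheme.{u} (𝒳 k) N R) (ch : (∀ k, 𝒳 k) → 𝒴 → ℝ)
    (D : Decoder 𝒳 𝒴 N R) (W : Fin K → Message N R) : ℝ :=
  probGiven 𝓛 ch W fun c y => D c y ≠ some W

/-- Collision miss detection probability. -/
def missDetectionProb (𝓛 : ∀ k, CodingScheme.{u} (𝒳 k) N R) (ch : (∀ k, 𝒳 k) → 𝒴 → ℝ)
    (D : Decoder 𝒳 𝒴 N R) (W : Fin K → Message N R) : ℝ :=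
  1 - probGiven 𝓛 ch W fun c y => D c y = none

/-- System error probability `P_es`; the suprema are over finite sets of message vectors, and
the maximum over an empty set of message vectors is `0`. -/
def systemErrorProb (𝓛 : ∀ k, CodingScheme.{u} (𝒳 k) N R) (ch : (∀ k, 𝒳 k) → 𝒴 → ℝ)
    (ℛ : Set (Fin K → ℝ)) (D : Decoder 𝒳 𝒴 N R) : ℝ :=
  max (⨆ W : {W : Fin K → Message N R // rateVec W ∈ ℛ}, decodingErrorProb 𝓛 ch D W.1)
    (⨆ W : {W : Fin K → Message N R // rateVec W ∉ ℛ}, missDetectionProb 𝓛 ch D W.1)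

/-- System error exponent `lim -(1/N) log P_es`, as a lower limit in the extended reals
(`log 0 = -∞`). -/
def systemErrorExponent (𝓛 : ∀ (N : ℕ) (k : Fin K), CodingScheme.{u} (𝒳 k) N R)
    (ch : (∀ k, 𝒳 k) → 𝒴 → ℝ) (ℛ : Set (Fin K → ℝ)) (D : ∀ N, Decoder 𝒳 𝒴 N R) : EReal :=
  liminf (fun N : ℕ => ((-(1 / (N : ℝ)) : ℝ) : EReal) *
    ENNReal.log (ENNReal.ofReal (systemErrorProb (𝓛 N) ch ℛ (D N)))) atTop

end MultiUser

section Exponents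

variable {K : ℕ} {𝒳 : Fin K → Type v} {𝒴 : Type w} [∀ k, Fintype (𝒳 k)] [Fintype 𝒴]

/-- `-log x` in the extended reals, for `x ≥ 0`, with `-log 0 = +∞`. -/
def negLog (x : ℝ) : EReal := -ENNReal.log (ENNReal.ofReal x)

/-- The input vector whose entries are `xS` on `S` and `xT` off `S`. -/
def join (S : Finset (Fin K)) (xS : ∀ k : {k // k ∈ S}, 𝒳 k)
    (xT : ∀ k : {k // k ∉ S}, 𝒳 k) : ∀ k, 𝒳 k :=
  (Equiv.piEquivPiSubtypeProd (fun k => k ∈ S) 𝒳).symm (xS, xT)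

/-- `∑_{X_{S̄}} ∏_{k ∉ S} P_k(X_k) P(y | X)^a` as a function of `X_S` and `y`. -/
def avgPow (ch : (∀ k, 𝒳 k) → 𝒴 → ℝ) (S : Finset (Fin K)) (P : ∀ k, 𝒳 k → ℝ) (a : ℝ)
    (xS : ∀ k : {k // k ∈ S}, 𝒳 k) (y : 𝒴) : ℝ :=
  ∑ xT : (∀ k : {k // k ∉ S}, 𝒳 k), (∏ k : {k // k ∉ S}, P k (xT k)) * ch (join S xS xT) y ^ a

/-- `E_m(S, r̃, P_{X|r}, P_{X|r̃})`, with `P = P_{X|r}` and `P' = P_{X|r̃}`. -/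
def Em (ch : (∀ k, 𝒳 k) → 𝒴 → ℝ) (S : Finset (Fin K)) (r' : Fin K → ℝ)
    (P P' : ∀ k, 𝒳 k → ℝ) : EReal :=
  ⨆ ρ ∈ Set.Ioc (0 : ℝ) 1, ((-ρ * ∑ k ∈ Sᶜ, r' k : ℝ) : EReal) +
    ⨆ s ∈ Set.Ioc (0 : ℝ) 1, negLog (∑ y, ∑ xS : (∀ k : {k // k ∈ S}, 𝒳 k),
      (∏ k : {k // k ∈ S}, P k (xS k)) * avgPow ch S P (1 - s) xS y * avgPow ch S P' (s / ρ) xS y ^ ρ)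

/-- `E_i(S, r, P_{X|r}, P_{X|r'})`, with `P = P_{X|r}` and `P' = P_{X|r'}`. -/
def Ei (ch : (∀ k, 𝒳 k) → 𝒴 → ℝ) (S : Finset (Fin K)) (r : Fin K → ℝ)
    (P P' : ∀ k, 𝒳 k → ℝ) : EReal :=
  ⨆ ρ ∈ Set.Ioc (0 : ℝ) 1, ((-ρ * ∑ k ∈ Sᶜ, r k : ℝ) : EReal) +
    ⨆ s ∈ Set.Ioc (0 : ℝ) (1 - ρ), negLog (∑ y, ∑ xS : (∀ k : {k // k ∈ S}, 𝒳 k),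
      (∏ k : {k // k ∈ S}, P k (xS k)) * avgPow ch S P (s / (s + ρ)) xS y ^ (s + ρ) *
        avgPow ch S P' 1 xS y ^ (1 - s))

/-- The bound on the system error exponent: the minimum, over all proper subsets `S` of users, of
`E_m` over pairs `r, r̃ ∈ ℛ` and of `E_i` over pairs `r ∈ ℛ`, `r̃ ∈ [0, R]^K ∖ ℛ`, where
`r` and `r̃` agree on `S`. -/
def exponentBound (ch : (∀ k, 𝒳 k) → 𝒴 → ℝ) (P : ∀ k, ℝ → 𝒳 k → ℝ) (R : ℝ)
    (ℛ : Set (Fin K → ℝ)) : EReal :=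
  min
    (⨅ (S : Finset (Fin K)) (_ : S ⊂ Finset.univ) (r ∈ ℛ) (r' ∈ ℛ) (_ : ∀ k ∈ S, r k = r' k),
      Em ch S r' (fun k => P k (r k)) (fun k => P k (r' k)))
    (⨅ (S : Finset (Fin K)) (_ : S ⊂ Finset.univ) (r ∈ ℛ) (r' ∈ rateBox K R \ ℛ)
      (_ : ∀ k ∈ S, r k = r' k),
      Ei ch S r (fun k => P k (r k)) (fun k => P k (r' k)))

end Exponents

end RandomAccess

end

/-!
The decoder is a maximum likelihood decoder over the message vectors with rates in the operation
region, which reports a collision unless the most likely vector is unique and its likelihood passes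
a threshold for every set `S` of users and every class of competing vectors. An error event is
split according to the set `S` of users on which the sent vector `W` and the competing vector `W'`
agree. Given the codeword of `W`, the letters of `W'` off `S` are fresh and independent
(`joint_law`), so Gallager's bound applies: the indicator of a union is at most the `u`-th power of
a sum, `u ≤ 1`, and Jensen's inequality moves the expectation inside the power
(`probGiven_le_of_union`). All the quantities are products over time, so the bounds are `N`-th
powers of single-letter sums. Comparing two vectors in the region gives `E_m` (`confusion_le`). A
vector outside the region is compared with the threshold only; a threshold depending on `Y` and
`X_S` that balances the rejection of a correct vector (`rejection_le`) against the acceptance of a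
wrong one (`acceptance_le`) gives `E_i` on both sides.

The parameters `(ρ, s)` may depend on the pair of rate vectors, whereas a union bound without loss
of exponent allows only finitely many choices. This is resolved by compactness of the set of
profiles (rates and input distributions of a pair). If `P_n → P` on a finite alphabet then
`P_n ≥ θ P` for every `θ < 1` eventually, and the single-letter sums are monotone and homogeneous of
bounded degree in the distributions. Hence the optimized exponents are upper semicontinuous, and a
lower bound on them extends to the closure of the set of profiles
(`exists_letterBound_lt_of_mem_closure`). For fixed `(ρ, s)` the sums are continuous, so finitely
many profiles, slightly raised, dominate all others with a margin (`exists_finite_cover`). The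
margin absorbs the difference between the input distributions at length `N` and their limits,
which is uniformly small (`FollowsAsymptotic.eventually_abs_sub_le`).

The decoders so obtained depend on the exponent to be reached. Since there are finitely many
decoders for each length, one with the least system error probability serves for all exponents
below the bound.
-/

noncomputable section

namespace RandomAccess

/-! ### Laws of the codewords -/

section Law

variable {K : ℕ} {𝒳 : Fin K → Type v} {𝒴 : Type w} {N : ℕ} {R : ℝ}

/-- The letters sent by all users, time by time, when the message vector is `W` and the users
have the codebooks `c`. -/
def codeword (c : ∀ k, Codebook (𝒳 k) N R) (W : Fin K → Message N R) : Fin N → ∀ k, 𝒳 k :=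
  fun j k => c k (W k) j

/-- Probability of the output sequence `y` on the input sequence `x` over the memoryless
channel. -/
def likelihood (ch : (∀ k, 𝒳 k) → 𝒴 → ℝ) (x : Fin N → ∀ k, 𝒳 k) (y : Fin N → 𝒴) : ℝ :=
  ∏ j, ch (x j) (y j)

/-- The users whose messages agree in two message vectors. -/
def agreeSet (W W' : Fin K → Message N R) : Finset (Fin K) :=
  Finset.univ.filter fun k => W k = W' k

lemma mem_agreeSet {W W' : Fin K → Message N R} {k : Fin K} :
    k ∈ agreeSet W W' ↔ W k = W' k := by
  simp [agreeSet]

lemma likelihood_nonneg {ch : (∀ k, 𝒳 k) → 𝒴 → ℝ} (hch : ∀ x y, 0 ≤ ch x y)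
    (x : Fin N → ∀ k, 𝒳 k) (y : Fin N → 𝒴) : 0 ≤ likelihood ch x y :=
  Finset.prod_nonneg fun _ _ => hch _ _

variable [∀ k, Fintype (𝒳 k)] [∀ k, MeasurableSpace (𝒳 k)]

/-- The law of the codebooks drawn by all users. -/
def bookLaw (𝓛 : ∀ k, CodingScheme.{u} (𝒳 k) N R) (c : ∀ k, Codebook (𝒳 k) N R) : ℝ :=
  ((Measure.pi fun k => (𝓛 k).γ).map fun θ k => (𝓛 k).book (θ k)).real {c}

lemma bookLaw_nonneg (𝓛 : ∀ k, CodingScheme.{u} (𝒳 k) N R) (c : ∀ k, Codebook (𝒳 k) N R) :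
    0 ≤ bookLaw 𝓛 c := measureReal_nonneg

lemma measurable_books (𝓛 : ∀ k, CodingScheme.{u} (𝒳 k) N R) :
    Measurable fun (θ : ∀ k, (𝓛 k).Θ) k => (𝓛 k).book (θ k) := by
  refine measurable_pi_iff.2 fun k => measurable_pi_iff.2 fun W => measurable_pi_iff.2 fun j => ?_
  exact ((𝓛 k).measurable_book W j).comp (measurable_pi_apply k)

variable [∀ k, MeasurableSingletonClass (𝒳 k)]

open Classical in
lemma sum_bookLaw_filter (𝓛 : ∀ k, CodingScheme.{u} (𝒳 k) N R)
    (p : (∀ k, Codebook (𝒳 k) N R) → Prop) :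
    ∑ c with p c, bookLaw 𝓛 c =
      (Measure.pi fun k => (𝓛 k).γ).real {θ | p fun k => (𝓛 k).book (θ k)} := by
  unfold bookLaw
  rw [sum_measureReal_singleton, map_measureReal_apply (measurable_books 𝓛)
    (Set.toFinite _).measurableSet]
  congr 1
  ext θ
  simp

/-- Distribution of the pair formed by the letter `a` of a message `W` and the letter `b` of a
message `W'` of one user, at the same time: the letters are equal if `W = W'` and independent
otherwise. -/
def pairWeight {𝒳 : Type v} [Fintype 𝒳] [MeasurableSpace 𝒳] (𝓛 : CodingScheme.{u} 𝒳 N R)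
    (W W' : Message N R) (a b : 𝒳) : ℝ :=
  open Classical in
  if W = W' then (if a = b then 𝓛.inputDist W a else 0)
  else 𝓛.inputDist W a * 𝓛.inputDist W' b

lemma pair_law {𝒳 : Type v} [Fintype 𝒳] [MeasurableSpace 𝒳] [MeasurableSingletonClass 𝒳]
    (𝓛 : CodingScheme.{u} 𝒳 N R) (W W' : Message N R) (x x' : Fin N → 𝒳) :
    𝓛.γ.real {θ | ∀ j, 𝓛.book θ W j = x j ∧ 𝓛.book θ W' j = x' j} =
      ∏ j, pairWeight 𝓛 W W' (x j) (x' j) := by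
  classical
  have hset : {θ | ∀ j, 𝓛.book θ W j = x j ∧ 𝓛.book θ W' j = x' j} =
      ⋂ p ∈ ({W, W'} : Finset (Message N R)) ×ˢ (Finset.univ : Finset (Fin N)),
        (fun θ => 𝓛.book θ p.1 p.2) ⁻¹' {a | (p.1 = W → a = x p.2) ∧ (p.1 = W' → a = x' p.2)} := by
    ext θ
    simp only [Set.mem_ofPred_eq, Set.mem_iInter, Finset.mem_product, Finset.mem_insert,
      Finset.mem_singleton, Finset.mem_univ, and_true, Set.mem_preimage, Prod.forall]
    constructor
    · rintro h V j -
      exact ⟨fun e => e ▸ (h j).1, fun e => e ▸ (h j).2⟩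
    · intro h j
      exact ⟨(h W j (Or.inl rfl)).1 rfl, (h W' j (Or.inr rfl)).2 rfl⟩
  rw [measureReal_def, hset, 𝓛.indep.measure_inter_preimage_eq_mul _
    (fun _ _ => (Set.toFinite _).measurableSet), ENNReal.toReal_prod, Finset.prod_product_right]
  refine Finset.prod_congr rfl fun j _ => ?_
  have hlaw : ∀ (V : Message N R) (a : 𝒳),
      (𝓛.γ ((fun θ => 𝓛.book θ V j) ⁻¹' {a})).toReal = 𝓛.inputDist V a := fun V a => 𝓛.law V j a
  unfold pairWeight
  by_cases h : W = W'
  · subst h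
    simp only [Finset.pair_eq_singleton, Finset.prod_singleton, forall_true_left, if_true]
    by_cases hx : x j = x' j
    · rw [if_pos hx, ← hlaw]
      congr 2
      ext θ
      simp [hx]
    · rw [if_neg hx]
      have : {a | a = x j ∧ a = x' j} = (∅ : Set 𝒳) := by
        ext a
        simp only [Set.mem_ofPred_eq, Set.mem_empty_iff_false, iff_false]
        rintro ⟨rfl, h⟩
        exact hx h
      simp [this]
  · rw [Finset.prod_pair h, if_neg h, ← hlaw, ← hlaw]
    congr 3
    · ext θ
      simp [h]
    · ext θ
      simp [Ne.symm h]

/-- Joint law of the codewords of two message vectors: memoryless, with independent users. -/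
lemma joint_law (𝓛 : ∀ k, CodingScheme.{u} (𝒳 k) N R) (W W' : Fin K → Message N R)
    (x x' : Fin N → ∀ k, 𝒳 k) [DecidablePred fun c : ∀ k, Codebook (𝒳 k) N R =>
      codeword c W = x ∧ codeword c W' = x'] :
    ∑ c with codeword c W = x ∧ codeword c W' = x', bookLaw 𝓛 c =
      ∏ j, ∏ k, pairWeight (𝓛 k) (W k) (W' k) (x j k) (x' j k) := by
  have h := sum_bookLaw_filter 𝓛 fun c => codeword c W = x ∧ codeword c W' = x'
  have hset : {θ : ∀ k, (𝓛 k).Θ | codeword (fun k => (𝓛 k).book (θ k)) W = x ∧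
        codeword (fun k => (𝓛 k).book (θ k)) W' = x'} =
      Set.univ.pi fun k => {θ | ∀ j, (𝓛 k).book θ (W k) j = x j k ∧
        (𝓛 k).book θ (W' k) j = x' j k} := by
    ext θ
    simp only [codeword, funext_iff, Set.mem_ofPred_eq, Set.mem_pi, Set.mem_univ, forall_true_left]
    exact ⟨fun h k j => ⟨h.1 j k, h.2 j k⟩, fun h => ⟨fun j k => (h k j).1, fun j k => (h k j).2⟩⟩
  rw [hset, measureReal_def, Measure.pi_pi, ENNReal.toReal_prod] at h
  rw [Finset.prod_comm, ← Finset.prod_congr rfl fun k _ =>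
    pair_law (𝓛 k) (W k) (W' k) (fun j => x j k) fun j => x' j k]
  simp only [measureReal_def]
  convert h

variable [Fintype 𝒴]

open Classical in
lemma probGiven_eq_sum (𝓛 : ∀ k, CodingScheme.{u} (𝒳 k) N R) (ch : (∀ k, 𝒳 k) → 𝒴 → ℝ)
    (W : Fin K → Message N R) (A : (∀ k, Codebook (𝒳 k) N R) → (Fin N → 𝒴) → Prop) :
    probGiven 𝓛 ch W A =
      ∑ c, bookLaw 𝓛 c * ∑ y, if A c y then likelihood ch (codeword c W) y else 0 := by
  have h := integral_fintype (μ := (Measure.pi fun k => (𝓛 k).γ).map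
    fun θ k => (𝓛 k).book (θ k)) (f := fun c => ∑ y : Fin N → 𝒴,
      if A c y then likelihood ch (codeword c W) y else 0) Integrable.of_finite
  rw [integral_map (measurable_books 𝓛).aemeasurable
    (measurable_of_finite _).aestronglyMeasurable] at h
  exact h

end Law

/-! ### Gallager's union bound -/

section Join

variable {K : ℕ} {𝒳 : Fin K → Type v} {𝒴 : Type w} (S : Finset (Fin K))

lemma join_of_mem (xS : ∀ k : {k // k ∈ S}, 𝒳 k) (xT : ∀ k : {k // k ∉ S}, 𝒳 k)
    (k : {k // k ∈ S}) : join S xS xT k = xS k := by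
  rw [join, Equiv.piEquivPiSubtypeProd_symm_apply, dif_pos k.2]

lemma join_of_notMem (xS : ∀ k : {k // k ∈ S}, 𝒳 k) (xT : ∀ k : {k // k ∉ S}, 𝒳 k)
    (k : {k // k ∉ S}) : join S xS xT k = xT k := by
  rw [join, Equiv.piEquivPiSubtypeProd_symm_apply, dif_neg k.2]

lemma join_restrict (x : ∀ k, 𝒳 k) :
    join S (fun k : {k // k ∈ S} => x k) (fun k : {k // k ∉ S} => x k) = x :=
  (Equiv.piEquivPiSubtypeProd (fun k => k ∈ S) 𝒳).symm_apply_apply x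

lemma prod_eq_prod_mul_prod_subtype {M : Type*} [CommMonoid M] (f : Fin K → M) :
    ∏ k, f k = (∏ k : {k // k ∈ S}, f k) * ∏ k : {k // k ∉ S}, f k := by
  convert (Fintype.prod_subtype_mul_prod_subtype (fun k => k ∈ S) f).symm

variable [∀ k, Fintype (𝒳 k)]

lemma sum_eq_sum_join {M : Type*} [AddCommMonoid M] (f : (∀ k, 𝒳 k) → M) :
    ∑ x, f x = ∑ xS, ∑ xT, f (join S xS xT) := by
  rw [← Fintype.sum_prod_type', ← (Equiv.piEquivPiSubtypeProd (fun k => k ∈ S) 𝒳).symm.sum_comp]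
  rfl

/-- Averaging over the letters off `S` of a product distribution. -/
lemma sum_prod_mul_eq (ch : (∀ k, 𝒳 k) → 𝒴 → ℝ) (P : ∀ k, 𝒳 k → ℝ) (a : ℝ) (y : 𝒴)
    (h : (∀ k : {k // k ∈ S}, 𝒳 k) → ℝ) :
    ∑ x : ∀ k, 𝒳 k, (∏ k, P k (x k)) * ch x y ^ a * h (fun k => x k) =
      ∑ xS : (∀ k : {k // k ∈ S}, 𝒳 k),
        (∏ k : {k // k ∈ S}, P k (xS k)) * avgPow ch S P a xS y * h xS := by
  rw [sum_eq_sum_join S]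
  refine Finset.sum_congr rfl fun xS _ => ?_
  rw [avgPow, Finset.mul_sum, Finset.sum_mul]
  refine Finset.sum_congr rfl fun xT _ => ?_
  rw [prod_eq_prod_mul_prod_subtype S]
  simp only [join_of_mem, join_of_notMem]
  ring

lemma avgPow_nonneg {ch : (∀ k, 𝒳 k) → 𝒴 → ℝ} (hch : ∀ x y, 0 ≤ ch x y) {P : ∀ k, 𝒳 k → ℝ}
    (hP : ∀ k ∉ S, ∀ x, 0 ≤ P k x) (a : ℝ) (xS : ∀ k : {k // k ∈ S}, 𝒳 k) (y : 𝒴) :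
    0 ≤ avgPow ch S P a xS y :=
  Finset.sum_nonneg fun _ _ => mul_nonneg (Finset.prod_nonneg fun k _ => hP k k.2 _)
    (Real.rpow_nonneg (hch _ _) _)

lemma avgPow_mono {ch : (∀ k, 𝒳 k) → 𝒴 → ℝ} (hch : ∀ x y, 0 ≤ ch x y) {P Q : ∀ k, 𝒳 k → ℝ}
    (hP : ∀ k ∉ S, ∀ x, 0 ≤ P k x) (hPQ : ∀ k ∉ S, ∀ x, P k x ≤ Q k x) (a : ℝ)
    (xS : ∀ k : {k // k ∈ S}, 𝒳 k) (y : 𝒴) : avgPow ch S P a xS y ≤ avgPow ch S Q a xS y :=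
  Finset.sum_le_sum fun _ _ => mul_le_mul_of_nonneg_right
    (Finset.prod_le_prod (fun k _ => hP k k.2 _) fun k _ => hPQ k k.2 _)
    (Real.rpow_nonneg (hch _ _) _)

lemma avgPow_pos {ch : (∀ k, 𝒳 k) → 𝒴 → ℝ} (hch : ∀ x y, 0 ≤ ch x y) {P : ∀ k, 𝒳 k → ℝ}
    (hP : ∀ k ∉ S, ∀ x, 0 < P k x) (a : ℝ) {x : ∀ k, 𝒳 k} {y : 𝒴} (hx : 0 < ch x y) :
    0 < avgPow ch S P a (fun k => x k) y := by
  refine Finset.sum_pos' (fun _ _ => mul_nonneg (Finset.prod_nonneg fun k _ => (hP k k.2 _).le)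
    (Real.rpow_nonneg (hch _ _) _)) ⟨fun k => x k, Finset.mem_univ _, ?_⟩
  rw [join_restrict]
  exact mul_pos (Finset.prod_pos fun k _ => hP k k.2 _) (Real.rpow_pos_of_pos hx _)

end Join

section UnionBound

variable {K : ℕ} {𝒳 : Fin K → Type v} {𝒴 : Type w} {N : ℕ} {R : ℝ}

lemma sum_likelihood [Fintype 𝒴] {ch : (∀ k, 𝒳 k) → 𝒴 → ℝ} (hch : ∀ x, ch x ∈ stdSimplex ℝ 𝒴)
    (x : Fin N → ∀ k, 𝒳 k) : ∑ y, likelihood ch x y = 1 := by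
  classical
  unfold likelihood
  rw [← Fintype.prod_sum fun j y => ch (x j) y]
  exact Finset.prod_eq_one fun j _ => (hch (x j)).2

variable [∀ k, Fintype (𝒳 k)] [∀ k, MeasurableSpace (𝒳 k)]

/-- The input distributions of the messages in a message vector. -/
def dists (𝓛 : ∀ k, CodingScheme.{u} (𝒳 k) N R) (W : Fin K → Message N R) : ∀ k, 𝒳 k → ℝ :=
  fun k => (𝓛 k).inputDist (W k)

lemma dists_nonneg (𝓛 : ∀ k, CodingScheme.{u} (𝒳 k) N R) (W : Fin K → Message N R) (k : Fin K)
    (a : 𝒳 k) : 0 ≤ dists 𝓛 W k a := ((𝓛 k).inputDist_mem (W k)).1 a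

/-- Averaging over the letter of `W'`, given the letter `x` of `W`. -/
lemma sum_pairWeight_mul (𝓛 : ∀ k, CodingScheme.{u} (𝒳 k) N R) (ch : (∀ k, 𝒳 k) → 𝒴 → ℝ)
    (W W' : Fin K → Message N R) (a : ℝ) (x : ∀ k, 𝒳 k) (y : 𝒴) :
    ∑ x', (∏ k, pairWeight (𝓛 k) (W k) (W' k) (x k) (x' k)) * ch x' y ^ a =
      (∏ k, dists 𝓛 W k (x k)) *
        avgPow ch (agreeSet W W') (dists 𝓛 W') a (fun k => x k) y := by
  classical
  set S := agreeSet W W' with hS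
  rw [sum_eq_sum_join S]
  have h1 : ∀ (xS : ∀ k : {k // k ∈ S}, 𝒳 k) (xT : ∀ k : {k // k ∉ S}, 𝒳 k),
      ∏ k, pairWeight (𝓛 k) (W k) (W' k) (x k) (join S xS xT k) =
      (if (fun k : {k // k ∈ S} => x k) = xS then ∏ k, dists 𝓛 W k (x k) else 0) *
        ∏ k : {k // k ∉ S}, dists 𝓛 W' k (xT k) := by
    intro xS xT
    rw [prod_eq_prod_mul_prod_subtype S]
    simp only [join_of_mem, join_of_notMem]
    have h2 : ∀ k : {k // k ∈ S}, pairWeight (𝓛 k) (W k) (W' k) (x k) (xS k) =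
        if x k = xS k then dists 𝓛 W k (x k) else 0 := fun k => by
      rw [pairWeight, if_pos (mem_agreeSet.1 k.2)]; rfl
    have h3 : ∀ k : {k // k ∉ S}, pairWeight (𝓛 k) (W k) (W' k) (x k) (xT k) =
        dists 𝓛 W k (x k) * dists 𝓛 W' k (xT k) := fun k => by
      rw [pairWeight, if_neg fun h => k.2 (mem_agreeSet.2 h)]; rfl
    rw [Finset.prod_congr rfl fun k _ => h2 k, Finset.prod_congr rfl fun k _ => h3 k,
      Finset.prod_ite_zero, Finset.prod_mul_distrib]
    by_cases h : (fun k : {k // k ∈ S} => x k) = xS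
    · rw [if_pos h, if_pos fun k _ => congrFun h k,
        prod_eq_prod_mul_prod_subtype S fun k => dists 𝓛 W k (x k), mul_assoc]
    · rw [if_neg h, if_neg fun h' => h (funext fun k => h' k (Finset.mem_univ _))]
      simp
  simp only [h1, ite_mul, zero_mul, avgPow]
  rw [Finset.sum_comm]
  simp only [Finset.sum_ite_eq, Finset.mem_univ, if_true, Finset.mul_sum, mul_assoc]

variable [∀ k, MeasurableSingletonClass (𝒳 k)]

open Classical in
/-- Law of the codeword of a message vector. -/
lemma codeword_law (𝓛 : ∀ k, CodingScheme.{u} (𝒳 k) N R) (W : Fin K → Message N R)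
    (x : Fin N → ∀ k, 𝒳 k) :
    ∑ c with codeword c W = x, bookLaw 𝓛 c = ∏ j, ∏ k, dists 𝓛 W k (x j k) := by
  have h := joint_law 𝓛 W W x x
  simpa [pairWeight, dists] using h

variable [Fintype 𝒴]

open Classical in
lemma sum_bookLaw (𝓛 : ∀ k, CodingScheme.{u} (𝒳 k) N R) : ∑ c, bookLaw 𝓛 c = 1 := by
  have h := sum_bookLaw_filter 𝓛 fun _ => True
  simpa using h

lemma probGiven_add_not (𝓛 : ∀ k, CodingScheme.{u} (𝒳 k) N R) {ch : (∀ k, 𝒳 k) → 𝒴 → ℝ}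
    (hch : ∀ x, ch x ∈ stdSimplex ℝ 𝒴) (W : Fin K → Message N R)
    (A : (∀ k, Codebook (𝒳 k) N R) → (Fin N → 𝒴) → Prop) :
    probGiven 𝓛 ch W A + probGiven 𝓛 ch W (fun c y => ¬ A c y) = 1 := by
  classical
  rw [probGiven_eq_sum, probGiven_eq_sum, ← Finset.sum_add_distrib, ← sum_bookLaw 𝓛]
  refine Finset.sum_congr rfl fun c _ => ?_
  rw [← mul_add, ← Finset.sum_add_distrib]
  conv_rhs => rw [← mul_one (bookLaw 𝓛 c), ← sum_likelihood hch (codeword c W)]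
  congr 1
  refine Finset.sum_congr rfl fun y _ => ?_
  by_cases h : A c y <;> simp [h]

/-- The union bound. -/
lemma probGiven_le_sum (𝓛 : ∀ k, CodingScheme.{u} (𝒳 k) N R) {ch : (∀ k, 𝒳 k) → 𝒴 → ℝ}
    (hch : ∀ x y, 0 ≤ ch x y) (W : Fin K → Message N R) {ι : Type*} (I : Finset ι)
    {A : (∀ k, Codebook (𝒳 k) N R) → (Fin N → 𝒴) → Prop}
    {B : ι → (∀ k, Codebook (𝒳 k) N R) → (Fin N → 𝒴) → Prop}
    (h : ∀ c y, A c y → ∃ i ∈ I, B i c y) :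
    probGiven 𝓛 ch W A ≤ ∑ i ∈ I, probGiven 𝓛 ch W (B i) := by
  classical
  simp only [probGiven_eq_sum]
  rw [Finset.sum_comm]
  refine Finset.sum_le_sum fun c _ => ?_
  rw [← Finset.mul_sum, Finset.sum_comm]
  refine mul_le_mul_of_nonneg_left (Finset.sum_le_sum fun y _ => ?_) (bookLaw_nonneg 𝓛 c)
  have hL := likelihood_nonneg hch (codeword c W) y
  have h0 : ∀ i ∈ I, 0 ≤ if B i c y then likelihood ch (codeword c W) y else 0 := fun i _ => by
    split_ifs
    exacts [hL, le_rfl]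
  split_ifs with hA
  · obtain ⟨i, hi, hB⟩ := h c y hA
    refine le_trans ?_ (Finset.single_le_sum h0 hi)
    rw [if_pos hB]
  · exact Finset.sum_nonneg h0

open Classical in
/-- Gallager's union bound. If, on an event, the likelihood of the sent codeword is at most
`g · (∑ L^a)^u`, the sum being over the likelihoods of a class of message vectors which agree
with the sent one exactly on `S`, then Jensen's inequality, given the sent codeword, moves the
expectation inside the power `u ≤ 1`. -/
lemma probGiven_le_of_union (𝓛 : ∀ k, CodingScheme.{u} (𝒳 k) N R) {ch : (∀ k, 𝒳 k) → 𝒴 → ℝ}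
    (hch : ∀ x y, 0 ≤ ch x y) (W : Fin K → Message N R) (S : Finset (Fin K))
    (C : Finset (Fin K → Message N R)) (hCS : ∀ W' ∈ C, agreeSet W W' = S)
    {P : ∀ k, 𝒳 k → ℝ} (hCP : ∀ W' ∈ C, ∀ k ∉ S, ∀ x, dists 𝓛 W' k x ≤ P k x)
    {a u : ℝ} (hu : 0 < u) (hu1 : u ≤ 1)
    {g : (Fin N → ∀ k, 𝒳 k) → (Fin N → 𝒴) → ℝ} (hg : ∀ x y, 0 ≤ g x y)
    {A : (∀ k, Codebook (𝒳 k) N R) → (Fin N → 𝒴) → Prop}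
    (hA : ∀ c y, A c y → likelihood ch (codeword c W) y ≤
      g (codeword c W) y * (∑ W' ∈ C, likelihood ch (codeword c W') y ^ a) ^ u) :
    probGiven 𝓛 ch W A ≤ ∑ y : Fin N → 𝒴, ∑ x : Fin N → ∀ k, 𝒳 k,
      (∏ j, ∏ k, dists 𝓛 W k (x j k)) * g x y *
        (C.card * ∏ j, avgPow ch S P a (fun k => x j k) (y j)) ^ u := by
  rw [probGiven_eq_sum]
  simp only [Finset.mul_sum]
  rw [Finset.sum_comm]
  refine Finset.sum_le_sum fun y _ => ?_
  rw [← Finset.sum_fiberwise Finset.univ fun c => codeword c W]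
  refine Finset.sum_le_sum fun x _ => ?_
  set q := ∏ j, ∏ k, dists 𝓛 W k (x j k) with hq
  have hq0 : 0 ≤ q := Finset.prod_nonneg fun j _ => Finset.prod_nonneg fun k _ =>
    dists_nonneg 𝓛 W k _
  set G : (∀ k, Codebook (𝒳 k) N R) → ℝ :=
    fun c => ∑ W' ∈ C, likelihood ch (codeword c W') y ^ a with hG
  have hG0 : ∀ c, 0 ≤ G c := fun c => Finset.sum_nonneg fun W' _ =>
    Real.rpow_nonneg (likelihood_nonneg hch _ _) _
  have step1 : ∑ c with codeword c W = x, bookLaw 𝓛 c *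
      (if A c y then likelihood ch (codeword c W) y else 0) ≤
      g x y * ∑ c with codeword c W = x, bookLaw 𝓛 c * G c ^ u := by
    rw [Finset.mul_sum]
    refine Finset.sum_le_sum fun c hc => ?_
    have hcx : codeword c W = x := (Finset.mem_filter.1 hc).2
    rw [mul_left_comm]
    refine mul_le_mul_of_nonneg_left ?_ (bookLaw_nonneg 𝓛 c)
    split_ifs with h
    · simpa only [hcx] using hA c y h
    · exact mul_nonneg (hg _ _) (Real.rpow_nonneg (hG0 c) _)
  have step2 : ∑ c with codeword c W = x, bookLaw 𝓛 c * G c ^ u ≤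
      q ^ (1 - u) * (∑ c with codeword c W = x, bookLaw 𝓛 c * G c) ^ u := by
    have h := Real.inner_le_weight_mul_Lp_of_nonneg
      (Finset.univ.filter fun c => codeword c W = x) (p := u⁻¹) ((one_le_inv₀ hu).2 hu1)
      (bookLaw 𝓛) (fun c => G c ^ u) (bookLaw_nonneg 𝓛) fun c => Real.rpow_nonneg (hG0 c) _
    rw [codeword_law, inv_inv, ← hq] at h
    simpa only [← Real.rpow_mul (hG0 _), mul_inv_cancel₀ hu.ne', Real.rpow_one] using h
  have step3 : ∑ c with codeword c W = x, bookLaw 𝓛 c * G c ≤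
      q * (C.card * ∏ j, avgPow ch S P a (fun k => x j k) (y j)) := by
    have hone : ∀ W' ∈ C, ∑ c with codeword c W = x,
        bookLaw 𝓛 c * likelihood ch (codeword c W') y ^ a ≤
        q * ∏ j, avgPow ch S P a (fun k => x j k) (y j) := by
      intro W' hW'
      calc ∑ c with codeword c W = x, bookLaw 𝓛 c * likelihood ch (codeword c W') y ^ a
          = ∑ x', (∏ j, ∏ k, pairWeight (𝓛 k) (W k) (W' k) (x j k) (x' j k)) *
              likelihood ch x' y ^ a := by
            rw [← Finset.sum_fiberwise _ fun c => codeword c W']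
            refine Finset.sum_congr rfl fun x' _ => ?_
            rw [← joint_law, Finset.sum_mul, Finset.filter_filter]
            refine Finset.sum_congr rfl fun c hc => ?_
            rw [(Finset.mem_filter.1 hc).2.2]
        _ = ∏ j, ∑ x', (∏ k, pairWeight (𝓛 k) (W k) (W' k) (x j k) (x' k)) *
              ch x' (y j) ^ a := by
            rw [Fintype.prod_sum]
            refine Finset.sum_congr rfl fun x' _ => ?_
            rw [Finset.prod_mul_distrib, likelihood,
              Real.finsetProd_rpow _ _ fun j _ => hch _ _]
        _ = q * ∏ j, avgPow ch S (dists 𝓛 W') a (fun k => x j k) (y j) := by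
            rw [hq, ← Finset.prod_mul_distrib]
            refine Finset.prod_congr rfl fun j _ => ?_
            rw [sum_pairWeight_mul, hCS W' hW']
        _ ≤ _ := mul_le_mul_of_nonneg_left (Finset.prod_le_prod
            (fun j _ => avgPow_nonneg S hch (fun k _ => dists_nonneg 𝓛 W' k) _ _ _)
            fun j _ => avgPow_mono S hch (fun k _ => dists_nonneg 𝓛 W' k) (hCP W' hW') _ _ _) hq0
    simp only [hG, Finset.mul_sum]
    rw [Finset.sum_comm]
    refine (Finset.sum_le_card_nsmul _ _ _ hone).trans_eq ?_
    rw [nsmul_eq_mul]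
    ring
  have hpow : q ^ (1 - u) * q ^ u = q := by
    rw [← Real.rpow_add_of_nonneg hq0 (by linarith) hu.le]
    simp
  set B := (C.card * ∏ j, avgPow ch S P a (fun k => x j k) (y j) : ℝ) with hB
  have hS0 : 0 ≤ ∑ c with codeword c W = x, bookLaw 𝓛 c * G c :=
    Finset.sum_nonneg fun c _ => mul_nonneg (bookLaw_nonneg 𝓛 c) (hG0 c)
  have step4 : (∑ c with codeword c W = x, bookLaw 𝓛 c * G c) ^ u ≤ q ^ u * B ^ u := by
    rcases C.eq_empty_or_nonempty with hC | ⟨V, hV⟩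
    · have : ∑ c with codeword c W = x, bookLaw 𝓛 c * G c = 0 := by simp [hG, hC]
      rw [this, Real.zero_rpow hu.ne', hB, hC]
      simp [Real.zero_rpow hu.ne']
    · have hB0 : 0 ≤ B := mul_nonneg (Nat.cast_nonneg _) (Finset.prod_nonneg fun j _ =>
        avgPow_nonneg S hch (fun k hk b => (dists_nonneg 𝓛 V k b).trans (hCP V hV k hk b)) _ _ _)
      rw [← Real.mul_rpow hq0 hB0]
      exact Real.rpow_le_rpow hS0 step3 hu.le
  calc _ ≤ g x y * (q ^ (1 - u) * (q ^ u * B ^ u)) :=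
        step1.trans (mul_le_mul_of_nonneg_left (step2.trans (mul_le_mul_of_nonneg_left step4
          (Real.rpow_nonneg hq0 _))) (hg _ _))
    _ = q * g x y * B ^ u := by rw [← mul_assoc (q ^ (1 - u)), hpow]; ring

end UnionBound

/-! ### Single-letter bounds on the error events -/

section SingleLetter

variable {K : ℕ} {𝒳 : Fin K → Type v} {𝒴 : Type w} [∀ k, Fintype (𝒳 k)] [Fintype 𝒴]

/-- The common form of the sums in the exponents: `E_m` has `(a, α, b, β) = (1-s, 1, s/ρ, ρ)` and
`E_i` has `(a, α, b, β) = (s/(s+ρ), s+ρ, 1, 1-s)`. -/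
def letterSum (ch : (∀ k, 𝒳 k) → 𝒴 → ℝ) (S : Finset (Fin K)) (P P' : ∀ k, 𝒳 k → ℝ)
    (a α b β : ℝ) : ℝ :=
  ∑ y, ∑ xS : (∀ k : {k // k ∈ S}, 𝒳 k),
    (∏ k : {k // k ∈ S}, P k (xS k)) * avgPow ch S P a xS y ^ α * avgPow ch S P' b xS y ^ β

lemma sum_sum_prod_eq_pow {α β : Type*} [Fintype α] [Fintype β] (N : ℕ) (h : α → β → ℝ) :
    ∑ y : Fin N → β, ∑ x : Fin N → α, ∏ j, h (x j) (y j) = (∑ y, ∑ x, h x y) ^ N := by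
  rw [Fintype.sum_pow]
  refine Finset.sum_congr rfl fun y _ => ?_
  rw [Fintype.prod_sum]

/-- The factor of one letter in the acceptance threshold. Where an average vanishes, the power with
a possibly negative exponent is a junk value; it does no harm, as the likelihoods which are then
compared with the threshold are zero if `P` and `P'` are positive. -/
def letterThreshold (ch : (∀ k, 𝒳 k) → 𝒴 → ℝ) (S : Finset (Fin K)) (P P' : ∀ k, 𝒳 k → ℝ)
    (ρ s : ℝ) (x : ∀ k, 𝒳 k) (y : 𝒴) : ℝ :=
  avgPow ch S P' 1 (fun k => x k) y ^ (1 - s) *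
    avgPow ch S P (s / (s + ρ)) (fun k => x k) y ^ (s + ρ - 1)

/-- The acceptance threshold of a class of message vectors with rates at most `r` and input
distributions at most `P`, against message vectors with input distributions at most `P'`. A word
`x` passes at the output `y` if its likelihood to the power `ρ/(s+ρ)` exceeds the threshold. The
threshold depends on the letters in `S` only. -/
def threshold (ch : (∀ k, 𝒳 k) → 𝒴 → ℝ) (S : Finset (Fin K)) (r : Fin K → ℝ)
    (P P' : ∀ k, 𝒳 k → ℝ) (ρ s : ℝ) {N : ℕ} (x : Fin N → ∀ k, 𝒳 k) (y : Fin N → 𝒴) : ℝ :=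
  Real.exp (N * (ρ * ∑ k ∈ Sᶜ, r k)) * ∏ j, letterThreshold ch S P P' ρ s (x j) (y j)

end SingleLetter

section Threshold

variable {K : ℕ} {𝒳 : Fin K → Type v} {𝒴 : Type w} [∀ k, Fintype (𝒳 k)]

lemma letterThreshold_nonneg {ch : (∀ k, 𝒳 k) → 𝒴 → ℝ} (hch : ∀ x y, 0 ≤ ch x y)
    (S : Finset (Fin K)) {P P' : ∀ k, 𝒳 k → ℝ} (hP : ∀ k x, 0 ≤ P k x)
    (hP' : ∀ k x, 0 ≤ P' k x) (ρ s : ℝ) (x : ∀ k, 𝒳 k) (y : 𝒴) :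
    0 ≤ letterThreshold ch S P P' ρ s x y :=
  mul_nonneg (Real.rpow_nonneg (avgPow_nonneg S hch (fun k _ => hP' k) _ _ _) _)
    (Real.rpow_nonneg (avgPow_nonneg S hch (fun k _ => hP k) _ _ _) _)

end Threshold

section Counting

variable {K : ℕ} {N : ℕ} {R : ℝ}

lemma card_rate_le (hN : 0 < N) (r : ℝ) :
    ((Finset.univ.filter fun V : Message N R => rate V ≤ r).card : ℝ) ≤ Real.exp (N * r) := by
  have hN' : (0 : ℝ) < N := Nat.cast_pos.2 hN
  have h : (Finset.univ.filter fun V : Message N R => rate V ≤ r).card ≤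
      (Finset.Icc 1 ⌊Real.exp (N * r)⌋₊).card := by
    refine Finset.card_le_card_of_injOn Subtype.val ?_ Subtype.val_injective.injOn
    intro V hV
    have hV1 : 1 ≤ V.1 := (Finset.mem_Icc.1 V.2).1
    have hr : rate V ≤ r := (Finset.mem_filter.1 hV).2
    refine Finset.mem_coe.2 (Finset.mem_Icc.2 ⟨hV1, Nat.le_floor ?_⟩)
    rw [rate, one_div_mul_eq_div, div_le_iff₀ hN'] at hr
    rw [← Real.log_le_iff_le_exp (by exact_mod_cast hV1)]
    linarith
  refine (Nat.cast_le.2 h).trans ?_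
  rw [Nat.card_Icc, Nat.add_sub_cancel]
  exact Nat.floor_le (Real.exp_pos _).le

open Classical in
lemma card_class_le (hN : 0 < N) (W : Fin K → Message N R) (S : Finset (Fin K)) (r : Fin K → ℝ)
    (C : Finset (Fin K → Message N R)) (hCS : ∀ W' ∈ C, agreeSet W W' = S)
    (hCr : ∀ W' ∈ C, ∀ k ∉ S, rate (W' k) ≤ r k) :
    (C.card : ℝ) ≤ Real.exp (N * ∑ k ∈ Sᶜ, r k) := by
  have h : C.card ≤ (Fintype.piFinset fun k : {k // k ∈ Sᶜ} =>
      Finset.univ.filter fun V : Message N R => rate V ≤ r k).card := by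
    refine Finset.card_le_card_of_injOn (fun W' k => W' k) ?_ ?_
    · intro W' hW'
      refine Finset.mem_coe.2 (Fintype.mem_piFinset.2 fun k => Finset.mem_filter.2
        ⟨Finset.mem_univ _, hCr W' hW' k (Finset.mem_compl.1 k.2)⟩)
    · intro W₁ h₁ W₂ h₂ h
      funext k
      by_cases hk : k ∈ S
      · have e₁ : W k = W₁ k := mem_agreeSet.1 ((hCS W₁ h₁).symm ▸ hk)
        have e₂ : W k = W₂ k := mem_agreeSet.1 ((hCS W₂ h₂).symm ▸ hk)
        rw [← e₁, ← e₂]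
      · exact congrFun h ⟨k, Finset.mem_compl.2 hk⟩
  refine (Nat.cast_le.2 h).trans ?_
  rw [Fintype.card_piFinset, Nat.cast_prod, Finset.mul_sum, Real.exp_sum,
    ← Finset.prod_coe_sort Sᶜ]
  exact Finset.prod_le_prod (fun _ _ => Nat.cast_nonneg _) fun k _ => card_rate_le hN _

end Counting

section Bounds

variable {K : ℕ} {𝒳 : Fin K → Type v} {𝒴 : Type w} {N : ℕ} {R : ℝ}
  [∀ k, Fintype (𝒳 k)] [∀ k, MeasurableSpace (𝒳 k)] [∀ k, MeasurableSingletonClass (𝒳 k)]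
  [Fintype 𝒴]

open Classical in
/-- Single-letter form of Gallager's union bound. -/
lemma probGiven_le_pow_of_union (𝓛 : ∀ k, CodingScheme.{u} (𝒳 k) N R)
    {ch : (∀ k, 𝒳 k) → 𝒴 → ℝ} (hch : ∀ x y, 0 ≤ ch x y) (W : Fin K → Message N R)
    (S : Finset (Fin K)) (C : Finset (Fin K → Message N R)) (hCS : ∀ W' ∈ C, agreeSet W W' = S)
    {P : ∀ k, 𝒳 k → ℝ} (hP : ∀ k ∉ S, ∀ x, 0 ≤ P k x)
    (hCP : ∀ W' ∈ C, ∀ k ∉ S, ∀ x, dists 𝓛 W' k x ≤ P k x)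
    {a u M κ : ℝ} (hu : 0 < u) (hu1 : u ≤ 1) (hM : C.card ≤ M) (hκ : 0 ≤ κ)
    {g : (∀ k, 𝒳 k) → 𝒴 → ℝ} (hg : ∀ x y, 0 ≤ g x y)
    {A : (∀ k, Codebook (𝒳 k) N R) → (Fin N → 𝒴) → Prop}
    (hA : ∀ c y, A c y → likelihood ch (codeword c W) y ≤
      (κ * ∏ j, g (codeword c W j) (y j)) *
        (∑ W' ∈ C, likelihood ch (codeword c W') y ^ a) ^ u) :
    probGiven 𝓛 ch W A ≤ κ * M ^ u * (∑ y, ∑ x : ∀ k, 𝒳 k,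
      (∏ k, dists 𝓛 W k (x k)) * g x y * avgPow ch S P a (fun k => x k) y ^ u) ^ N := by
  refine (probGiven_le_of_union 𝓛 hch W S C hCS hCP hu hu1
    (g := fun x y => κ * ∏ j, g (x j) (y j))
    (fun x y => mul_nonneg hκ (Finset.prod_nonneg fun j _ => hg _ _)) hA).trans ?_
  rw [← sum_sum_prod_eq_pow, Finset.mul_sum]
  refine Finset.sum_le_sum fun y _ => ?_
  rw [Finset.mul_sum]
  refine Finset.sum_le_sum fun x _ => ?_
  have hav : ∀ j, 0 ≤ avgPow ch S P a (fun k => x j k) (y j) := fun j =>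
    avgPow_nonneg S hch hP _ _ _
  have hq0 : 0 ≤ ∏ j, ∏ k, dists 𝓛 W k (x j k) := Finset.prod_nonneg fun j _ =>
    Finset.prod_nonneg fun k _ => dists_nonneg 𝓛 W k _
  rw [Real.mul_rpow (Nat.cast_nonneg _) (Finset.prod_nonneg fun j _ => hav j),
    ← Real.finsetProd_rpow _ _ fun j _ => hav j, Finset.prod_mul_distrib, Finset.prod_mul_distrib]
  have h1 : (C.card : ℝ) ^ u ≤ M ^ u := Real.rpow_le_rpow (Nat.cast_nonneg _) hM hu.le
  have h2 : 0 ≤ (∏ j, ∏ k, dists 𝓛 W k (x j k)) * (κ * ∏ j, g (x j) (y j)) *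
      ∏ j, avgPow ch S P a (fun k => x j k) (y j) ^ u :=
    mul_nonneg (mul_nonneg hq0 (mul_nonneg hκ (Finset.prod_nonneg fun j _ => hg _ _)))
      (Finset.prod_nonneg fun j _ => Real.rpow_nonneg (hav j) _)
  nlinarith [mul_le_mul_of_nonneg_left h1 h2]

/-- Single-letter bound on an event that bounds the likelihood of the sent codeword. -/
lemma probGiven_le_pow (𝓛 : ∀ k, CodingScheme.{u} (𝒳 k) N R)
    {ch : (∀ k, 𝒳 k) → 𝒴 → ℝ} (hch : ∀ x y, 0 ≤ ch x y) (W : Fin K → Message N R)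
    {κ : ℝ} (hκ : 0 ≤ κ) {g : (∀ k, 𝒳 k) → 𝒴 → ℝ} (hg : ∀ x y, 0 ≤ g x y)
    {A : (∀ k, Codebook (𝒳 k) N R) → (Fin N → 𝒴) → Prop}
    (hA : ∀ c y, A c y → likelihood ch (codeword c W) y ≤
      κ * ∏ j, g (codeword c W j) (y j)) :
    probGiven 𝓛 ch W A ≤ κ * (∑ y, ∑ x : ∀ k, 𝒳 k, (∏ k, dists 𝓛 W k (x k)) * g x y) ^ N := by
  -- the union bound for the class `{W}`, with exponents `a = 0` and `u = 1`
  have h := probGiven_le_pow_of_union 𝓛 hch W Finset.univ {W}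
    (by simp [agreeSet]) (P := dists 𝓛 W) (fun k hk => absurd (Finset.mem_univ k) hk)
    (by simp) (a := 0) (u := 1) (M := 1) (κ := κ) one_pos le_rfl (by simp) hκ hg (A := A)
    (by simpa using hA)
  have : IsEmpty {k : Fin K // k ∉ Finset.univ} := ⟨fun k => k.2 (Finset.mem_univ _)⟩
  simpa [avgPow] using h

/-- Probability that a message vector of a class beats the sent one. -/
lemma confusion_le (hN : 0 < N) (𝓛 : ∀ k, CodingScheme.{u} (𝒳 k) N R)
    {ch : (∀ k, 𝒳 k) → 𝒴 → ℝ} (hch : ∀ x y, 0 ≤ ch x y) (W : Fin K → Message N R)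
    (S : Finset (Fin K)) (r : Fin K → ℝ) {P P' : ∀ k, 𝒳 k → ℝ} {ρ s : ℝ}
    (hρ : ρ ∈ Set.Ioc 0 1) (hs : s ∈ Set.Ioc 0 1)
    (hWP : ∀ k x, dists 𝓛 W k x ≤ P k x) (hP' : ∀ k x, 0 ≤ P' k x) :
    probGiven 𝓛 ch W (fun c y => ∃ W', agreeSet W W' = S ∧ (∀ k, rate (W' k) ≤ r k) ∧
        (∀ k x, dists 𝓛 W' k x ≤ P' k x) ∧
        likelihood ch (codeword c W) y ≤ likelihood ch (codeword c W') y) ≤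
      (Real.exp (ρ * ∑ k ∈ Sᶜ, r k) * letterSum ch S P P' (1 - s) 1 (s / ρ) ρ) ^ N := by
  classical
  set C := Finset.univ.filter fun W' : Fin K → Message N R => agreeSet W W' = S ∧
    (∀ k, rate (W' k) ≤ r k) ∧ ∀ k x, dists 𝓛 W' k x ≤ P' k x with hC
  have hmem : ∀ W' ∈ C, agreeSet W W' = S ∧ (∀ k, rate (W' k) ≤ r k) ∧
    ∀ k x, dists 𝓛 W' k x ≤ P' k x := fun W' h => (Finset.mem_filter.1 h).2
  refine (probGiven_le_pow_of_union 𝓛 hch W S C (fun W' h => (hmem W' h).1)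
    (fun k _ => hP' k) (fun W' h k _ => (hmem W' h).2.2 k) (a := s / ρ) hρ.1 hρ.2
    (card_class_le hN W S r C (fun W' h => (hmem W' h).1) fun W' h k _ => (hmem W' h).2.1 k)
    zero_le_one (g := fun x y => ch x y ^ (1 - s)) (fun x y => Real.rpow_nonneg (hch _ _) _)
    ?_).trans ?_
  · rintro c y ⟨W', h1, h2, h3, h4⟩
    have hL := likelihood_nonneg hch (codeword c W) y
    rw [Real.finsetProd_rpow _ _ fun j _ => hch _ _, one_mul]
    change likelihood ch (codeword c W) y ≤ likelihood ch (codeword c W) y ^ (1 - s) * _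
    -- one competitor that is at least as likely makes the sum of ratios at least one
    have h5 : likelihood ch (codeword c W) y ^ s ≤
        (∑ W' ∈ C, likelihood ch (codeword c W') y ^ (s / ρ)) ^ ρ := by
      calc _ ≤ likelihood ch (codeword c W') y ^ s := Real.rpow_le_rpow hL h4 hs.1.le
        _ = (likelihood ch (codeword c W') y ^ (s / ρ)) ^ ρ := by
          rw [← Real.rpow_mul (hL.trans h4), div_mul_cancel₀ _ hρ.1.ne']
        _ ≤ _ := by
          refine Real.rpow_le_rpow (Real.rpow_nonneg (hL.trans h4) _) ?_ hρ.1.le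
          exact Finset.single_le_sum (f := fun W' => likelihood ch (codeword c W') y ^ (s / ρ))
            (fun V _ => Real.rpow_nonneg (likelihood_nonneg hch _ _) _)
            (Finset.mem_filter.2 ⟨Finset.mem_univ _, h1, h2, h3⟩)
    calc likelihood ch (codeword c W) y
        = likelihood ch (codeword c W) y ^ (1 - s) * likelihood ch (codeword c W) y ^ s := by
          rw [← Real.rpow_add_of_nonneg hL (by linarith [hs.2]) hs.1.le]
          simp
      _ ≤ _ := mul_le_mul_of_nonneg_left h5 (Real.rpow_nonneg hL _)
  · rw [one_mul, ← Real.exp_mul, mul_pow, ← Real.exp_nat_mul]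
    have hsum : ∑ y, ∑ x : ∀ k, 𝒳 k, (∏ k, dists 𝓛 W k (x k)) * ch x y ^ (1 - s) *
        avgPow ch S P' (s / ρ) (fun k => x k) y ^ ρ ≤
        letterSum ch S P P' (1 - s) 1 (s / ρ) ρ := by
      refine Finset.sum_le_sum fun y _ => ?_
      simp only [Real.rpow_one]
      rw [← sum_prod_mul_eq S ch P (1 - s) y fun xS => avgPow ch S P' (s / ρ) xS y ^ ρ]
      refine Finset.sum_le_sum fun x _ => ?_
      refine mul_le_mul_of_nonneg_right (mul_le_mul_of_nonneg_right
        (Finset.prod_le_prod (fun k _ => dists_nonneg 𝓛 W k _) fun k _ => hWP k _)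
        (Real.rpow_nonneg (hch _ _) _))
        (Real.rpow_nonneg (avgPow_nonneg S hch (fun k _ => hP' k) _ _ _) _)
    have h0 : 0 ≤ ∑ y, ∑ x : ∀ k, 𝒳 k, (∏ k, dists 𝓛 W k (x k)) * ch x y ^ (1 - s) *
        avgPow ch S P' (s / ρ) (fun k => x k) y ^ ρ :=
      Finset.sum_nonneg fun y _ => Finset.sum_nonneg fun x _ => mul_nonneg (mul_nonneg
        (Finset.prod_nonneg fun k _ => dists_nonneg 𝓛 W k _) (Real.rpow_nonneg (hch _ _) _))
        (Real.rpow_nonneg (avgPow_nonneg S hch (fun k _ => hP' k) _ _ _) _)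
    refine mul_le_mul (le_of_eq ?_) (pow_le_pow_left₀ h0 hsum N) (pow_nonneg h0 _)
      (Real.exp_pos _).le
    congr 1
    ring

/-- Probability that the sent codeword fails to pass the threshold. -/
lemma rejection_le (𝓛 : ∀ k, CodingScheme.{u} (𝒳 k) N R)
    {ch : (∀ k, 𝒳 k) → 𝒴 → ℝ} (hch : ∀ x y, 0 ≤ ch x y) (W : Fin K → Message N R)
    (S : Finset (Fin K)) (r : Fin K → ℝ) {P P' : ∀ k, 𝒳 k → ℝ} {ρ s : ℝ}
    (hρ : 0 < ρ) (hs : 0 < s)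
    (hWP : ∀ k x, dists 𝓛 W k x ≤ P k x) (hP' : ∀ k x, 0 ≤ P' k x) :
    probGiven 𝓛 ch W (fun c y => likelihood ch (codeword c W) y ^ (ρ / (s + ρ)) ≤
        threshold ch S r P P' ρ s (codeword c W) y) ≤
      (Real.exp (ρ * ∑ k ∈ Sᶜ, r k) * letterSum ch S P P' (s / (s + ρ)) (s + ρ) 1 (1 - s)) ^ N := by
  have hP : ∀ k x, 0 ≤ P k x := fun k x => (dists_nonneg 𝓛 W k x).trans (hWP k x)
  have hA0 : ∀ xS y, 0 ≤ avgPow ch S P (s / (s + ρ)) xS y := fun xS y =>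
    avgPow_nonneg S hch (fun k _ => hP k) _ _ _
  have hA0' : ∀ xS y, 0 ≤ avgPow ch S P' 1 xS y := fun xS y =>
    avgPow_nonneg S hch (fun k _ => hP' k) _ _ _
  have hg0 : ∀ x y, 0 ≤ ch x y ^ (s / (s + ρ)) * letterThreshold ch S P P' ρ s x y := fun x y =>
    mul_nonneg (Real.rpow_nonneg (hch _ _) _) (letterThreshold_nonneg hch S hP hP' _ _ _ _)
  refine (probGiven_le_pow 𝓛 hch W (κ := Real.exp (N * (ρ * ∑ k ∈ Sᶜ, r k))) (Real.exp_pos _).le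
    hg0 ?_).trans ?_
  · intro c y h
    have hL := likelihood_nonneg hch (codeword c W) y
    -- split `L = L^(s/(s+ρ)) L^(ρ/(s+ρ))` and bound the second factor by the threshold
    rw [Finset.prod_mul_distrib, Real.finsetProd_rpow _ _ fun j _ => hch _ _]
    calc likelihood ch (codeword c W) y = likelihood ch (codeword c W) y ^ (s / (s + ρ)) *
          likelihood ch (codeword c W) y ^ (ρ / (s + ρ)) := by
          rw [← Real.rpow_add_of_nonneg hL (by positivity) (by positivity), ← add_div,
            div_self (by positivity), Real.rpow_one]
      _ ≤ likelihood ch (codeword c W) y ^ (s / (s + ρ)) *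
          threshold ch S r P P' ρ s (codeword c W) y :=
          mul_le_mul_of_nonneg_left h (Real.rpow_nonneg hL _)
      _ = _ := by
          rw [threshold, likelihood]
          ring
  · rw [mul_pow, ← Real.exp_nat_mul]
    refine mul_le_mul_of_nonneg_left (pow_le_pow_left₀ (Finset.sum_nonneg fun y _ =>
      Finset.sum_nonneg fun x _ => mul_nonneg (Finset.prod_nonneg fun k _ =>
        dists_nonneg 𝓛 W k _) (hg0 _ _)) ?_ N) (Real.exp_pos _).le
    refine Finset.sum_le_sum fun y _ => ?_
    calc ∑ x : ∀ k, 𝒳 k, (∏ k, dists 𝓛 W k (x k)) *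
          (ch x y ^ (s / (s + ρ)) * letterThreshold ch S P P' ρ s x y)
        ≤ ∑ x : ∀ k, 𝒳 k, (∏ k, P k (x k)) * ch x y ^ (s / (s + ρ)) *
          letterThreshold ch S P P' ρ s x y := by
          refine Finset.sum_le_sum fun x _ => ?_
          rw [mul_assoc]
          exact mul_le_mul_of_nonneg_right
            (Finset.prod_le_prod (fun k _ => dists_nonneg 𝓛 W k _) fun k _ => hWP k _) (hg0 x y)
      _ = ∑ xS : (∀ k : {k // k ∈ S}, 𝒳 k), (∏ k : {k // k ∈ S}, P k (xS k)) *
          avgPow ch S P (s / (s + ρ)) xS y * (avgPow ch S P' 1 xS y ^ (1 - s) *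
            avgPow ch S P (s / (s + ρ)) xS y ^ (s + ρ - 1)) :=
          sum_prod_mul_eq S ch P _ y fun xS => avgPow ch S P' 1 xS y ^ (1 - s) *
            avgPow ch S P (s / (s + ρ)) xS y ^ (s + ρ - 1)
      _ ≤ _ := by
          refine Finset.sum_le_sum fun xS _ => ?_
          have hp : 0 ≤ ∏ k : {k // k ∈ S}, P k (xS k) := Finset.prod_nonneg fun k _ => hP _ _
          rcases (hA0 xS y).eq_or_lt with h | h
          · rw [← h, mul_zero, zero_mul, Real.zero_rpow (by positivity)]
            simp
          · refine le_of_eq ?_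
            have : avgPow ch S P (s / (s + ρ)) xS y ^ (s + ρ) =
                avgPow ch S P (s / (s + ρ)) xS y *
                  avgPow ch S P (s / (s + ρ)) xS y ^ (s + ρ - 1) := by
              rw [Real.rpow_sub_one h.ne', mul_div_cancel₀ _ h.ne']
            rw [this]
            ring

/-- Probability that a message vector of a class passes the threshold when another message vector
is sent. -/
lemma acceptance_le (hN : 0 < N) (𝓛 : ∀ k, CodingScheme.{u} (𝒳 k) N R)
    {ch : (∀ k, 𝒳 k) → 𝒴 → ℝ} (hch : ∀ x y, 0 ≤ ch x y) (V : Fin K → Message N R)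
    (S : Finset (Fin K)) (r : Fin K → ℝ) {P P' : ∀ k, 𝒳 k → ℝ} {ρ s : ℝ}
    (hρ : 0 < ρ) (hs : s ∈ Set.Ioc 0 (1 - ρ))
    (hVP : ∀ k ∈ S, ∀ x, dists 𝓛 V k x ≤ P k x) (hVP' : ∀ k x, dists 𝓛 V k x ≤ P' k x)
    (hP : ∀ k x, 0 < P k x) (hP' : ∀ k x, 0 < P' k x) :
    probGiven 𝓛 ch V (fun c y => ∃ W, agreeSet V W = S ∧ (∀ k, rate (W k) ≤ r k) ∧
        (∀ k x, dists 𝓛 W k x ≤ P k x) ∧ threshold ch S r P P' ρ s (codeword c W) y <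
          likelihood ch (codeword c W) y ^ (ρ / (s + ρ))) ≤
      (Real.exp (ρ * ∑ k ∈ Sᶜ, r k) * letterSum ch S P P' (s / (s + ρ)) (s + ρ) 1 (1 - s)) ^ N := by
  classical
  obtain ⟨hs0, hs1⟩ := hs
  have hs2 : 0 < 1 - s := by linarith
  set C := Finset.univ.filter fun W : Fin K → Message N R => agreeSet V W = S ∧
    (∀ k, rate (W k) ≤ r k) ∧ ∀ k x, dists 𝓛 W k x ≤ P k x with hC
  have hmem : ∀ W ∈ C, agreeSet V W = S ∧ (∀ k, rate (W k) ≤ r k) ∧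
    ∀ k x, dists 𝓛 W k x ≤ P k x := fun W h => (Finset.mem_filter.1 h).2
  have hA0 : ∀ xS y, 0 ≤ avgPow ch S P (s / (s + ρ)) xS y := fun xS y =>
    avgPow_nonneg S hch (fun k _ x => (hP k x).le) _ _ _
  have hA0' : ∀ xS y, 0 ≤ avgPow ch S P' 1 xS y := fun xS y =>
    avgPow_nonneg S hch (fun k _ x => (hP' k x).le) _ _ _
  have ht0 : ∀ x y, 0 ≤ letterThreshold ch S P P' ρ s x y :=
    letterThreshold_nonneg hch S (fun k x => (hP k x).le) (fun k x => (hP' k x).le) ρ s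
  have hg0 : ∀ x y, 0 ≤ ch x y * letterThreshold ch S P P' ρ s x y ^ (-(s / (1 - s))) := fun x y =>
    mul_nonneg (hch _ _) (Real.rpow_nonneg (ht0 _ _) _)
  refine (probGiven_le_pow_of_union 𝓛 hch V S C (fun W h => (hmem W h).1)
    (fun k _ x => (hP k x).le) (fun W h k _ => (hmem W h).2.2 k) (a := s / (s + ρ))
    -- `ρ/(1-s) ≤ 1` is where the constraint `s ≤ 1 - ρ` enters
    (u := ρ / (1 - s)) (κ := Real.exp (N * (ρ * ∑ k ∈ Sᶜ, r k)) ^ (-(s / (1 - s))))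
    (div_pos hρ hs2) ((div_le_one hs2).2 (by linarith))
    (card_class_le hN V S r C (fun W h => (hmem W h).1) fun W h k _ => (hmem W h).2.1 k)
    (Real.rpow_nonneg (Real.exp_pos _).le _) hg0 ?_).trans ?_
  · rintro c y ⟨W, h1, h2, h3, h4⟩
    have hLV := likelihood_nonneg hch (codeword c V) y
    have hLW := likelihood_nonneg hch (codeword c W) y
    have hsum0 : 0 ≤ ∑ W ∈ C, likelihood ch (codeword c W) y ^ (s / (s + ρ)) :=
      Finset.sum_nonneg fun W _ => Real.rpow_nonneg (likelihood_nonneg hch _ _) _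
    -- the threshold depends on the letters of the users in `S`, which `V` and `W` share
    have hVW : threshold ch S r P P' ρ s (codeword c W) y =
        threshold ch S r P P' ρ s (codeword c V) y := by
      have : ∀ j, (fun k : {k // k ∈ S} => codeword c W j k) =
          fun k : {k // k ∈ S} => codeword c V j k := fun j => by
        funext k
        have : V k = W k := mem_agreeSet.1 (h1.symm ▸ k.2)
        simp only [codeword, this]
      simp only [threshold, letterThreshold, this]
    rw [hVW] at h4
    set Θ := threshold ch S r P P' ρ s (codeword c V) y with hΘ
    have hΘ0 : 0 ≤ Θ := mul_nonneg (Real.exp_pos _).le (Finset.prod_nonneg fun j _ => ht0 _ _)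
    have hrhs : Real.exp (N * (ρ * ∑ k ∈ Sᶜ, r k)) ^ (-(s / (1 - s))) *
        ∏ j, ch (codeword c V j) (y j) *
          letterThreshold ch S P P' ρ s (codeword c V j) (y j) ^ (-(s / (1 - s))) =
        likelihood ch (codeword c V) y * Θ ^ (-(s / (1 - s))) := by
      rw [Finset.prod_mul_distrib, Real.finsetProd_rpow _ _ fun j _ => ht0 _ _, hΘ, threshold,
        Real.mul_rpow (Real.exp_pos _).le (Finset.prod_nonneg fun j _ => ht0 _ _), likelihood]
      ring
    rw [hrhs, mul_assoc]
    rcases hLV.eq_or_lt with h0 | hLVpos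
    · rw [← h0, zero_mul]
    refine le_mul_of_one_le_right hLV ?_
    have hLWpos : 0 < likelihood ch (codeword c W) y := by
      refine hLW.lt_of_ne fun h0 => ?_
      rw [← h0, Real.zero_rpow (by positivity)] at h4
      exact h4.not_ge hΘ0
    have hchV : ∀ j, 0 < ch (codeword c V j) (y j) := fun j => (hch _ _).lt_of_ne fun h =>
      hLVpos.ne' (Finset.prod_eq_zero (Finset.mem_univ j) h.symm)
    have hΘpos : 0 < Θ := mul_pos (Real.exp_pos _) (Finset.prod_pos fun j _ => mul_pos
      (Real.rpow_pos_of_pos (avgPow_pos S hch (fun k _ => hP' k) _ (hchV j)) _)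
      (Real.rpow_pos_of_pos (avgPow_pos S hch (fun k _ => hP k) _ (hchV j)) _))
    have h5 : Θ ^ (s / (1 - s)) ≤
        (∑ W ∈ C, likelihood ch (codeword c W) y ^ (s / (s + ρ))) ^ (ρ / (1 - s)) := by
      calc Θ ^ (s / (1 - s)) ≤ (likelihood ch (codeword c W) y ^ (ρ / (s + ρ))) ^ (s / (1 - s)) :=
            Real.rpow_le_rpow hΘ0 h4.le (by positivity)
        _ = (likelihood ch (codeword c W) y ^ (s / (s + ρ))) ^ (ρ / (1 - s)) := by
            rw [← Real.rpow_mul hLW, ← Real.rpow_mul hLW]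
            congr 1
            ring
        _ ≤ _ := Real.rpow_le_rpow (Real.rpow_nonneg hLW _) (Finset.single_le_sum
            (f := fun W => likelihood ch (codeword c W) y ^ (s / (s + ρ)))
            (fun V _ => Real.rpow_nonneg (likelihood_nonneg hch _ _) _)
            (Finset.mem_filter.2 ⟨Finset.mem_univ _, h1, h2, h3⟩)) (by positivity)
    rw [Real.rpow_neg hΘ0, inv_mul_eq_div, one_le_div (Real.rpow_pos_of_pos hΘpos _)]
    exact h5
  · have hexp : Real.exp (N * (ρ * ∑ k ∈ Sᶜ, r k)) ^ (-(s / (1 - s))) *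
        Real.exp (N * ∑ k ∈ Sᶜ, r k) ^ (ρ / (1 - s)) = Real.exp (ρ * ∑ k ∈ Sᶜ, r k) ^ N := by
      rw [← Real.exp_mul, ← Real.exp_mul, ← Real.exp_add, ← Real.exp_nat_mul]
      congr 1
      field_simp
      ring
    rw [hexp, mul_pow]
    refine mul_le_mul_of_nonneg_left (pow_le_pow_left₀ (Finset.sum_nonneg fun y _ =>
      Finset.sum_nonneg fun x _ => mul_nonneg (mul_nonneg (Finset.prod_nonneg fun k _ =>
        dists_nonneg 𝓛 V k _) (hg0 _ _)) (Real.rpow_nonneg (hA0 _ _) _)) ?_ N)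
        (pow_nonneg (Real.exp_pos _).le _)
    refine Finset.sum_le_sum fun y _ => ?_
    -- a product distribution with factors `P` on `S` and `P'` off `S`
    set Q : ∀ k, 𝒳 k → ℝ := fun k => if k ∈ S then P k else P' k with hQ
    have hVQ : ∀ k x, dists 𝓛 V k x ≤ Q k x := fun k x => by
      by_cases hk : k ∈ S
      · simpa only [hQ, if_pos hk] using hVP k hk x
      · simpa only [hQ, if_neg hk] using hVP' k x
    have hQS : ∀ k : {k // k ∈ S}, Q k = P k := fun k => if_pos k.2
    have hQT : ∀ xS, avgPow ch S Q 1 xS y = avgPow ch S P' 1 xS y := fun xS => by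
      have : ∀ k : {k // k ∉ S}, Q k = P' k := fun k => if_neg k.2
      simp only [avgPow, this]
    calc ∑ x : ∀ k, 𝒳 k, (∏ k, dists 𝓛 V k (x k)) *
          (ch x y * letterThreshold ch S P P' ρ s x y ^ (-(s / (1 - s)))) *
          avgPow ch S P (s / (s + ρ)) (fun k => x k) y ^ (ρ / (1 - s))
        ≤ ∑ x : ∀ k, 𝒳 k, (∏ k, Q k (x k)) * ch x y ^ (1 : ℝ) *
          (letterThreshold ch S P P' ρ s x y ^ (-(s / (1 - s))) *
            avgPow ch S P (s / (s + ρ)) (fun k => x k) y ^ (ρ / (1 - s))) := by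
          refine Finset.sum_le_sum fun x _ => ?_
          have h := mul_le_mul_of_nonneg_right (mul_le_mul_of_nonneg_right
            (Finset.prod_le_prod (s := Finset.univ) (fun k _ => dists_nonneg 𝓛 V k _)
            fun k _ => hVQ k (x k)) (hg0 x y)) (Real.rpow_nonneg (hA0 (fun k => x k) y) (ρ / (1 - s)))
          rw [Real.rpow_one]
          linarith
      _ = ∑ xS : (∀ k : {k // k ∈ S}, 𝒳 k), (∏ k : {k // k ∈ S}, P k (xS k)) *
          avgPow ch S P' 1 xS y * ((avgPow ch S P' 1 xS y ^ (1 - s) *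
            avgPow ch S P (s / (s + ρ)) xS y ^ (s + ρ - 1)) ^ (-(s / (1 - s))) *
            avgPow ch S P (s / (s + ρ)) xS y ^ (ρ / (1 - s))) := by
          have h := sum_prod_mul_eq S ch Q 1 y fun xS => (avgPow ch S P' 1 xS y ^ (1 - s) *
            avgPow ch S P (s / (s + ρ)) xS y ^ (s + ρ - 1)) ^ (-(s / (1 - s))) *
            avgPow ch S P (s / (s + ρ)) xS y ^ (ρ / (1 - s))
          simp only [hQS, hQT] at h
          exact h
      _ ≤ _ := by
          refine Finset.sum_le_sum fun xS _ => ?_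
          have hp : 0 ≤ ∏ k : {k // k ∈ S}, P k (xS k) :=
            Finset.prod_nonneg fun k _ => (hP _ _).le
          rw [mul_assoc, mul_assoc]
          refine mul_le_mul_of_nonneg_left ?_ hp
          have hB := hA0' xS y
          have hA := hA0 xS y
          generalize avgPow ch S P' 1 xS y = B at hB ⊢
          generalize avgPow ch S P (s / (s + ρ)) xS y = A at hA ⊢
          rcases hB.eq_or_lt with rfl | hB
          · rw [zero_mul, Real.zero_rpow hs2.ne', mul_zero]
          rcases hA.eq_or_lt with rfl | hA
          · rw [Real.zero_rpow (div_pos hρ hs2).ne', mul_zero, mul_zero,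
              Real.zero_rpow (by positivity), zero_mul]
          refine le_of_eq ?_
          rw [Real.mul_rpow (Real.rpow_nonneg hB.le _) (Real.rpow_nonneg hA.le _),
            ← Real.rpow_mul hB.le, ← Real.rpow_mul hA.le]
          calc _ = (B ^ (1 : ℝ) * B ^ ((1 - s) * -(s / (1 - s)))) *
                (A ^ ((s + ρ - 1) * -(s / (1 - s))) * A ^ (ρ / (1 - s))) := by
                rw [Real.rpow_one]
                ring
            _ = _ := by
                rw [← Real.rpow_add hA, ← Real.rpow_add hB, mul_comm]
                congr 2
                · field_simp
                  ring
                · field_simp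
                  ring

end Bounds

/-! ### Finitely many classes of message pairs -/

section Stability

variable {K : ℕ} {𝒳 : Fin K → Type v} {𝒴 : Type w} [∀ k, Fintype (𝒳 k)]

lemma pow_mul_prod_le {ι : Type*} [Fintype ι] {m : ℕ} (hm : Fintype.card ι ≤ m) {θ : ℝ}
    (hθ : 0 ≤ θ) (hθ1 : θ ≤ 1) {f g : ι → ℝ} (hf : ∀ i, 0 ≤ f i) (hfg : ∀ i, θ * f i ≤ g i) :
    θ ^ m * ∏ i, f i ≤ ∏ i, g i :=
  calc θ ^ m * ∏ i, f i ≤ θ ^ Fintype.card ι * ∏ i, f i :=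
        mul_le_mul_of_nonneg_right (pow_le_pow_of_le_one hθ hθ1 hm)
          (Finset.prod_nonneg fun i _ => hf i)
    _ = ∏ i, θ * f i := by simp [Finset.prod_mul_distrib]
    _ ≤ ∏ i, g i := Finset.prod_le_prod (fun i _ => mul_nonneg hθ (hf i)) fun i _ => hfg i

lemma card_subtype_le (p : Fin K → Prop) [Fintype {k // p k}] : Fintype.card {k // p k} ≤ K :=
  (Fintype.card_subtype_le p).trans_eq (Fintype.card_fin K)

lemma pow_mul_avgPow_le {ch : (∀ k, 𝒳 k) → 𝒴 → ℝ} (hch : ∀ x y, 0 ≤ ch x y)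
    (S : Finset (Fin K)) {P Q : ∀ k, 𝒳 k → ℝ} {θ : ℝ} (hθ : 0 ≤ θ) (hθ1 : θ ≤ 1)
    (hP : ∀ k x, 0 ≤ P k x) (hPQ : ∀ k x, θ * P k x ≤ Q k x) (a : ℝ)
    (xS : ∀ k : {k // k ∈ S}, 𝒳 k) (y : 𝒴) :
    θ ^ K * avgPow ch S P a xS y ≤ avgPow ch S Q a xS y := by
  rw [avgPow, Finset.mul_sum]
  refine Finset.sum_le_sum fun xT _ => ?_
  rw [← mul_assoc]
  exact mul_le_mul_of_nonneg_right (pow_mul_prod_le (card_subtype_le _) hθ hθ1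
    (fun k => hP k _) fun k => hPQ k _) (Real.rpow_nonneg (hch _ _) _)

lemma mul_rpow_le_rpow {t A B α : ℝ} (ht : 0 < t) (ht1 : t ≤ 1) (hA : 0 ≤ A) (hAB : t * A ≤ B)
    (hα : α ∈ Set.Ioc 0 1) : t * A ^ α ≤ B ^ α :=
  calc t * A ^ α ≤ t ^ α * A ^ α := by
        refine mul_le_mul_of_nonneg_right ?_ (Real.rpow_nonneg hA _)
        simpa using Real.rpow_le_rpow_of_exponent_ge ht ht1 hα.2
    _ = (t * A) ^ α := (Real.mul_rpow ht.le hA).symm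
    _ ≤ B ^ α := Real.rpow_le_rpow (mul_nonneg ht.le hA) hAB hα.1.le

variable [Fintype 𝒴]

/-- Lowering the distributions by a factor `θ` lowers the sums in the exponents by at most
`θ^(3K)`, whatever the parameters `(a, α, b, β)`. -/
lemma pow_mul_letterSum_le {ch : (∀ k, 𝒳 k) → 𝒴 → ℝ} (hch : ∀ x y, 0 ≤ ch x y)
    (S : Finset (Fin K)) {P P' Q Q' : ∀ k, 𝒳 k → ℝ} {θ : ℝ} (hθ : 0 < θ) (hθ1 : θ ≤ 1)
    (hP : ∀ k x, 0 ≤ P k x) (hP' : ∀ k x, 0 ≤ P' k x) (hPQ : ∀ k x, θ * P k x ≤ Q k x)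
    (hPQ' : ∀ k x, θ * P' k x ≤ Q' k x) {α β : ℝ} (hα : α ∈ Set.Ioc 0 1)
    (hβ : β ∈ Set.Ioc 0 1) (a b : ℝ) :
    θ ^ (3 * K) * letterSum ch S P P' a α b β ≤ letterSum ch S Q Q' a α b β := by
  rw [letterSum, Finset.mul_sum]
  refine Finset.sum_le_sum fun y _ => ?_
  rw [Finset.mul_sum]
  refine Finset.sum_le_sum fun xS _ => ?_
  have ht : 0 < θ ^ K := pow_pos hθ K
  have ht1 : θ ^ K ≤ 1 := pow_le_one₀ hθ.le hθ1
  have hA := avgPow_nonneg S hch (fun k _ => hP k) a xS y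
  have hB := avgPow_nonneg S hch (fun k _ => hP' k) b xS y
  have hp : 0 ≤ ∏ k : {k // k ∈ S}, P k (xS k) := Finset.prod_nonneg fun k _ => hP _ _
  have h1 : θ ^ K * ∏ k : {k // k ∈ S}, P k (xS k) ≤ ∏ k : {k // k ∈ S}, Q k (xS k) :=
    pow_mul_prod_le (card_subtype_le _) hθ.le hθ1 (fun k => hP k _) fun k => hPQ k _
  have h2 := mul_rpow_le_rpow ht ht1 hA (pow_mul_avgPow_le hch S hθ.le hθ1 hP hPQ a xS y) hα
  have h3 := mul_rpow_le_rpow ht ht1 hB (pow_mul_avgPow_le hch S hθ.le hθ1 hP' hPQ' b xS y) hβ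
  have h1' := (mul_nonneg ht.le hp).trans h1
  have h2' := mul_nonneg ht.le (Real.rpow_nonneg hA α)
  have h3' := mul_nonneg ht.le (Real.rpow_nonneg hB β)
  calc _ = (θ ^ K * ∏ k : {k // k ∈ S}, P k (xS k)) * (θ ^ K * avgPow ch S P a xS y ^ α) *
        (θ ^ K * avgPow ch S P' b xS y ^ β) := by ring
    _ ≤ _ := mul_le_mul (mul_le_mul h1 h2 h2' h1') h3 h3' (mul_nonneg h1' (h2'.trans h2))

lemma letterSum_nonneg {ch : (∀ k, 𝒳 k) → 𝒴 → ℝ} (hch : ∀ x y, 0 ≤ ch x y)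
    (S : Finset (Fin K)) {P P' : ∀ k, 𝒳 k → ℝ} (hP : ∀ k x, 0 ≤ P k x)
    (hP' : ∀ k x, 0 ≤ P' k x) (a α b β : ℝ) : 0 ≤ letterSum ch S P P' a α b β :=
  Finset.sum_nonneg fun _ _ => Finset.sum_nonneg fun _ _ =>
    mul_nonneg (mul_nonneg (Finset.prod_nonneg fun _ _ => hP _ _)
      (Real.rpow_nonneg (avgPow_nonneg S hch (fun k _ => hP k) _ _ _) _))
      (Real.rpow_nonneg (avgPow_nonneg S hch (fun k _ => hP' k) _ _ _) _)

lemma continuous_letterSum (ch : (∀ k, 𝒳 k) → 𝒴 → ℝ) (S : Finset (Fin K)) {α β : ℝ}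
    (hα : 0 ≤ α) (hβ : 0 ≤ β) (a b : ℝ) :
    Continuous fun z : (∀ k, 𝒳 k → ℝ) × (∀ k, 𝒳 k → ℝ) => letterSum ch S z.1 z.2 a α b β := by
  unfold letterSum avgPow
  refine continuous_finsetSum _ fun y _ => continuous_finsetSum _ fun xS _ => ?_
  refine ((continuous_finsetProd _ fun k _ => ?_).mul
    ((continuous_finsetSum _ fun xT _ => ?_).rpow_const fun _ => Or.inr hα)).mul
    ((continuous_finsetSum _ fun xT _ => ?_).rpow_const fun _ => Or.inr hβ)
  · fun_prop
  · exact (continuous_finsetProd _ fun k _ => by fun_prop).mul continuous_const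
  · exact (continuous_finsetProd _ fun k _ => by fun_prop).mul continuous_const

end Stability

section Compactness

variable {K : ℕ} {𝒳 : Fin K → Type v} {𝒴 : Type w} [∀ k, Fintype (𝒳 k)] [Fintype 𝒴]

/-- Profile of a pair of message vectors: the rates of the vector that is output by mistake and
the input distributions of both. -/
abbrev Profile (𝒳 : Fin K → Type v) : Type v :=
  (Fin K → ℝ) × (∀ k, 𝒳 k → ℝ) × (∀ k, 𝒳 k → ℝ)

/-- The profile with all entries raised by `δ`. -/
def Profile.raise (z : Profile 𝒳) (δ : ℝ) : Profile 𝒳 :=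
  (fun k => z.1 k + δ, fun k x => z.2.1 k x + δ, fun k x => z.2.2 k x + δ)

/-- The bound on an error probability, per letter, at a profile: `e^{-E}` where `E` is the
expression under the suprema of `E_m` or `E_i`. -/
def letterBound (ch : (∀ k, 𝒳 k) → 𝒴 → ℝ) (S : Finset (Fin K)) (z : Profile 𝒳)
    (ρ a α b β : ℝ) : ℝ :=
  Real.exp (ρ * ∑ k ∈ Sᶜ, z.1 k) * letterSum ch S z.2.1 z.2.2 a α b β

lemma letterBound_nonneg {ch : (∀ k, 𝒳 k) → 𝒴 → ℝ} (hch : ∀ x y, 0 ≤ ch x y)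
    (S : Finset (Fin K)) {z : Profile 𝒳} (hP : ∀ k x, 0 ≤ z.2.1 k x) (hP' : ∀ k x, 0 ≤ z.2.2 k x)
    (ρ a α b β : ℝ) : 0 ≤ letterBound ch S z ρ a α b β :=
  mul_nonneg (Real.exp_pos _).le (letterSum_nonneg hch S hP hP' _ _ _ _)

lemma continuous_letterBound (ch : (∀ k, 𝒳 k) → 𝒴 → ℝ) (S : Finset (Fin K)) (ρ : ℝ) {α β : ℝ}
    (hα : 0 ≤ α) (hβ : 0 ≤ β) (a b : ℝ) :
    Continuous fun z : Profile 𝒳 => letterBound ch S z ρ a α b β := by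
  unfold letterBound
  refine Continuous.mul (by fun_prop) ((continuous_letterSum ch S hα hβ a b).comp continuous_snd)

/-- Near a limit of profiles the letter bound cannot be much smaller than at the limit, uniformly
in the parameters. Hence a bound for suitable parameters at every profile in a set extends to
the closure of the set. -/
lemma exists_letterBound_lt_of_mem_closure {ch : (∀ k, 𝒳 k) → 𝒴 → ℝ} (hch : ∀ x y, 0 ≤ ch x y)
    (S : Finset (Fin K)) {Λ : Type*} (L : Set Λ) (ρ a α b β : Λ → ℝ)
    (hρ : ∀ l ∈ L, ρ l ∈ Set.Ioc 0 1) (hα : ∀ l ∈ L, α l ∈ Set.Ioc 0 1)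
    (hβ : ∀ l ∈ L, β l ∈ Set.Ioc 0 1) {Z : Set (Profile 𝒳)}
    (hZ0 : ∀ z ∈ Z, (∀ k x, 0 ≤ z.2.1 k x) ∧ ∀ k x, 0 ≤ z.2.2 k x) {c c' : ℝ} (hcc' : c < c')
    (hZ : ∀ z ∈ Z, ∃ l ∈ L, letterBound ch S z (ρ l) (a l) (α l) (b l) (β l) < c)
    {z : Profile 𝒳} (hz : z ∈ closure Z)
    (hz0 : (∀ k x, 0 ≤ z.2.1 k x) ∧ ∀ k x, 0 ≤ z.2.2 k x) :
    ∃ l ∈ L, letterBound ch S z (ρ l) (a l) (α l) (b l) (β l) < c' := by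
  -- a factor `θ < 1` for the distributions, with room `1 - θ` for the sum of the rates
  obtain ⟨θ, ⟨hθ0, hθ1⟩, hθ⟩ : ∃ θ ∈ Set.Ioo (0 : ℝ) 1,
      c < θ ^ (3 * K) * Real.exp (-(1 - θ)) * c' := by
    have hcont : Continuous fun θ : ℝ => θ ^ (3 * K) * Real.exp (-(1 - θ)) * c' := by fun_prop
    have h1 : ∀ᶠ θ in 𝓝[<] (1 : ℝ), c < θ ^ (3 * K) * Real.exp (-(1 - θ)) * c' :=
      (hcont.tendsto 1).mono_left nhdsWithin_le_nhds |>.eventually_const_lt (by simpa)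
    have h2 : ∀ᶠ θ in 𝓝[<] (1 : ℝ), θ ∈ Set.Ioo (0 : ℝ) 1 := Ioo_mem_nhdsLT one_pos
    exact (h2.and h1).exists
  have hev1 : ∀ᶠ z' : Profile 𝒳 in 𝓝 z, ∑ k ∈ Sᶜ, z.1 k < ∑ k ∈ Sᶜ, z'.1 k + (1 - θ) := by
    have hcont : Continuous fun z' : Profile 𝒳 => ∑ k ∈ Sᶜ, z'.1 k + (1 - θ) := by fun_prop
    exact (hcont.tendsto z).eventually_const_lt (by linarith)
  have hscale : ∀ f : Profile 𝒳 → ℝ, Continuous f → 0 ≤ f z →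
      ∀ᶠ z' in 𝓝 z, 0 ≤ f z' → θ * f z ≤ f z' := by
    intro f hf h0
    rcases h0.eq_or_lt with h | h
    · filter_upwards with z' hz'
      rwa [← h, mul_zero]
    · filter_upwards [(hf.tendsto z).eventually_const_lt
        (show θ * f z < f z by nlinarith)] with z' hz' _ using hz'.le
  have hev2 : ∀ᶠ z' : Profile 𝒳 in 𝓝 z, ∀ k x, 0 ≤ z'.2.1 k x → θ * z.2.1 k x ≤ z'.2.1 k x :=
    eventually_all.2 fun k => eventually_all.2 fun x =>
      hscale (fun z => z.2.1 k x) (by fun_prop) (hz0.1 k x)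
  have hev3 : ∀ᶠ z' : Profile 𝒳 in 𝓝 z, ∀ k x, 0 ≤ z'.2.2 k x → θ * z.2.2 k x ≤ z'.2.2 k x :=
    eventually_all.2 fun k => eventually_all.2 fun x =>
      hscale (fun z => z.2.2 k x) (by fun_prop) (hz0.2 k x)
  obtain ⟨z', hz', h1, h2, h3⟩ :=
    ((mem_closure_iff_frequently.1 hz).and_eventually (hev1.and (hev2.and hev3))).exists
  obtain ⟨l, hl, hlc⟩ := hZ z' hz'
  refine ⟨l, hl, ?_⟩
  have hsum := pow_mul_letterSum_le hch S hθ0 hθ1.le hz0.1 hz0.2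
    (fun k x => h2 k x ((hZ0 z' hz').1 k x)) (fun k x => h3 k x ((hZ0 z' hz').2 k x))
    (hα l hl) (hβ l hl) (a l) (b l)
  have hexp : Real.exp (-(1 - θ)) * Real.exp (ρ l * ∑ k ∈ Sᶜ, z.1 k) ≤
      Real.exp (ρ l * ∑ k ∈ Sᶜ, z'.1 k) := by
    rw [← Real.exp_add, Real.exp_le_exp]
    nlinarith [(hρ l hl).1, (hρ l hl).2]
  have h0 := letterSum_nonneg hch S hz0.1 hz0.2 (a l) (α l) (b l) (β l)
  have hmul : θ ^ (3 * K) * Real.exp (-(1 - θ)) *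
      letterBound ch S z (ρ l) (a l) (α l) (b l) (β l) ≤
      letterBound ch S z' (ρ l) (a l) (α l) (b l) (β l) :=
    calc _ = (Real.exp (-(1 - θ)) * Real.exp (ρ l * ∑ k ∈ Sᶜ, z.1 k)) *
          (θ ^ (3 * K) * letterSum ch S z.2.1 z.2.2 (a l) (α l) (b l) (β l)) := by
          rw [letterBound]; ring
      _ ≤ _ := mul_le_mul hexp hsum (mul_nonneg (pow_pos hθ0 _).le h0) (Real.exp_pos _).le
  have hpos : 0 < θ ^ (3 * K) * Real.exp (-(1 - θ)) := mul_pos (pow_pos hθ0 _) (Real.exp_pos _)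
  exact lt_of_mul_lt_mul_left ((hmul.trans_lt hlc).trans hθ) hpos.le

/-- A bounded set of profiles with a letter bound less than `c`, for parameters that vary with the
profile, is covered by finitely many classes: each is the set of profiles dominated, with margin
`ε`, by some raised profile whose letter bound is less than `c'`. -/
lemma exists_finite_cover {ch : (∀ k, 𝒳 k) → 𝒴 → ℝ} (hch : ∀ x y, 0 ≤ ch x y)
    (S : Finset (Fin K)) {Λ : Type*} (L : Set Λ) (ρ a α b β : Λ → ℝ)
    (hρ : ∀ l ∈ L, ρ l ∈ Set.Ioc 0 1) (hα : ∀ l ∈ L, α l ∈ Set.Ioc 0 1)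
    (hβ : ∀ l ∈ L, β l ∈ Set.Ioc 0 1) {Z : Set (Profile 𝒳)} (hZb : Bornology.IsBounded Z)
    (hZ0 : ∀ z ∈ Z, (∀ k x, 0 ≤ z.2.1 k x) ∧ ∀ k x, 0 ≤ z.2.2 k x) {c c' : ℝ} (hcc' : c < c')
    (hZ : ∀ z ∈ Z, ∃ l ∈ L, letterBound ch S z (ρ l) (a l) (α l) (b l) (β l) < c) :
    ∃ ε > 0, ∃ T : Finset (Profile 𝒳 × Λ),
      (∀ t ∈ T, t.2 ∈ L ∧ (∀ k x, 0 < t.1.2.1 k x) ∧ (∀ k x, 0 < t.1.2.2 k x) ∧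
        letterBound ch S t.1 (ρ t.2) (a t.2) (α t.2) (b t.2) (β t.2) < c') ∧
      ∀ z ∈ Z, ∃ t ∈ T, z.raise ε ≤ t.1 := by
  classical
  have hclosed : IsClosed {z : Profile 𝒳 | (∀ k x, 0 ≤ z.2.1 k x) ∧ ∀ k x, 0 ≤ z.2.2 k x} := by
    simp only [Set.ofPred_and, Set.ofPred_forall]
    exact (isClosed_iInter fun k => isClosed_iInter fun x =>
      isClosed_le continuous_const (by fun_prop)).inter (isClosed_iInter fun k =>
        isClosed_iInter fun x => isClosed_le continuous_const (by fun_prop))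
  have hcl0 := closure_minimal hZ0 hclosed
  have hpt : ∀ z ∈ closure Z, ∃ l ∈ L, ∃ δ > 0,
      letterBound ch S (z.raise (2 * δ)) (ρ l) (a l) (α l) (b l) (β l) < c' := by
    intro z hz
    obtain ⟨l, hl, hlt⟩ := exists_letterBound_lt_of_mem_closure hch S L ρ a α b β hρ hα hβ hZ0
      hcc' hZ hz (hcl0 hz)
    refine ⟨l, hl, ?_⟩
    have hcont : Continuous fun δ : ℝ =>
        letterBound ch S (z.raise (2 * δ)) (ρ l) (a l) (α l) (b l) (β l) :=
      (continuous_letterBound ch S (ρ l) (hα l hl).1.le (hβ l hl).1.le (a l) (b l)).comp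
        (by unfold Profile.raise; fun_prop)
    have h1 : ∀ᶠ δ in 𝓝[>] (0 : ℝ),
        letterBound ch S (z.raise (2 * δ)) (ρ l) (a l) (α l) (b l) (β l) < c' :=
      (hcont.tendsto 0).mono_left nhdsWithin_le_nhds |>.eventually_lt_const
        (by simpa [Profile.raise] using hlt)
    obtain ⟨δ, h, h'⟩ := (h1.and self_mem_nhdsWithin).exists
    exact ⟨δ, h', h⟩
  choose l hl δ hδ h using hpt
  obtain ⟨t, hcov⟩ := (Metric.isCompact_of_isClosed_isBounded isClosed_closure
    hZb.closure).elim_nhds_subcover' (fun z hz => Metric.ball z (δ z hz))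
    fun z hz => Metric.ball_mem_nhds z (hδ z hz)
  obtain ⟨ε, hε, hεδ⟩ : ∃ ε > 0, ∀ z ∈ t, ε ≤ δ z.1 z.2 := by
    rcases t.eq_empty_or_nonempty with rfl | hne
    · exact ⟨1, one_pos, by simp⟩
    · obtain ⟨z, hz, hmin⟩ := t.exists_min_image (fun z => δ z.1 z.2) hne
      exact ⟨δ z.1 z.2, hδ z.1 z.2, hmin⟩
  refine ⟨ε, hε, t.image fun z => (z.1.raise (2 * δ z.1 z.2), l z.1 z.2), ?_, ?_⟩
  · intro p hp
    obtain ⟨z, hz, rfl⟩ := Finset.mem_image.1 hp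
    have h0 := mul_pos two_pos (hδ z.1 z.2)
    exact ⟨hl z.1 z.2, fun k x => add_pos_of_nonneg_of_pos ((hcl0 z.2).1 k x) h0,
      fun k x => add_pos_of_nonneg_of_pos ((hcl0 z.2).2 k x) h0, h z.1 z.2⟩
  · intro z' hz'
    obtain ⟨z, hz, hball⟩ := Set.mem_iUnion₂.1 (hcov (subset_closure hz'))
    refine ⟨_, Finset.mem_image_of_mem _ hz, ?_⟩
    have hεz := hεδ z hz
    rw [Metric.mem_ball, Prod.dist_eq, Prod.dist_eq, max_lt_iff, max_lt_iff] at hball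
    obtain ⟨hb1, hb2, hb3⟩ := hball
    have hle : ∀ {p q : ℝ}, dist p q < δ z.1 z.2 → p + ε ≤ q + 2 * δ z.1 z.2 := fun {p q} hpq => by
      have := (abs_lt.1 (Real.dist_eq p q ▸ hpq)).2
      linarith
    exact ⟨fun k => hle ((dist_le_pi_dist _ _ k).trans_lt hb1),
      fun k x => hle (((dist_le_pi_dist _ _ x).trans (dist_le_pi_dist _ _ k)).trans_lt hb2),
      fun k x => hle (((dist_le_pi_dist _ _ x).trans (dist_le_pi_dist _ _ k)).trans_lt hb3)⟩

end Compactness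

section ExponentForm

variable {K : ℕ} {𝒳 : Fin K → Type v} {𝒴 : Type w} [∀ k, Fintype (𝒳 k)] [Fintype 𝒴]

lemma lt_exp_neg_of_lt_negLog {b x : ℝ} (h : (b : EReal) < negLog x) : x < Real.exp (-b) := by
  rcases le_or_gt x 0 with hx | hx
  · exact hx.trans_lt (Real.exp_pos _)
  · rw [negLog, ENNReal.log_ofReal_of_pos hx, ← EReal.coe_neg, EReal.coe_lt_coe_iff] at h
    rw [← Real.log_lt_iff_lt_exp hx]
    linarith

lemma sub_lt_of_lt_coe_add {b x : ℝ} {y : EReal} (h : (b : EReal) < (x : EReal) + y) :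
    ((b - x : ℝ) : EReal) < y := by
  induction y with
  | bot => simp at h
  | top => exact EReal.coe_lt_top _
  | coe y =>
    rw [← EReal.coe_add, EReal.coe_lt_coe_iff] at h
    rw [EReal.coe_lt_coe_iff]
    linarith

/-- Parameters `(ρ, s)` of `E_m`. -/
def paramsEm : Set (ℝ × ℝ) := {l | l.1 ∈ Set.Ioc 0 1 ∧ l.2 ∈ Set.Ioc 0 1}

/-- Parameters `(ρ, s)` of `E_i`. -/
def paramsEi : Set (ℝ × ℝ) := {l | l.1 ∈ Set.Ioc 0 1 ∧ l.2 ∈ Set.Ioc 0 (1 - l.1)}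

lemma exists_letterBound_lt_of_lt_Em {ch : (∀ k, 𝒳 k) → 𝒴 → ℝ} {S : Finset (Fin K)}
    {r' : Fin K → ℝ} {P P' : ∀ k, 𝒳 k → ℝ} {b : ℝ} (h : (b : EReal) < Em ch S r' P P') :
    ∃ l ∈ paramsEm, letterBound ch S (r', P, P') l.1 (1 - l.2) 1 (l.2 / l.1) l.1 <
      Real.exp (-b) := by
  rw [Em] at h
  simp only [lt_iSup_iff] at h
  obtain ⟨ρ, hρ, h⟩ := h
  have h' := sub_lt_of_lt_coe_add h
  simp only [lt_iSup_iff] at h'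
  obtain ⟨s, hs, h'⟩ := h'
  refine ⟨(ρ, s), ⟨hρ, hs⟩, ?_⟩
  have h2 := lt_exp_neg_of_lt_negLog h'
  simp only [letterBound, letterSum, Real.rpow_one]
  refine (mul_lt_mul_of_pos_left h2 (Real.exp_pos _)).trans_eq ?_
  rw [← Real.exp_add]
  congr 1
  ring

lemma exists_letterBound_lt_of_lt_Ei {ch : (∀ k, 𝒳 k) → 𝒴 → ℝ} {S : Finset (Fin K)}
    {r : Fin K → ℝ} {P P' : ∀ k, 𝒳 k → ℝ} {b : ℝ} (h : (b : EReal) < Ei ch S r P P') :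
    ∃ l ∈ paramsEi, letterBound ch S (r, P, P') l.1 (l.2 / (l.2 + l.1)) (l.2 + l.1) 1 (1 - l.2) <
      Real.exp (-b) := by
  rw [Ei] at h
  simp only [lt_iSup_iff] at h
  obtain ⟨ρ, hρ, h⟩ := h
  have h' := sub_lt_of_lt_coe_add h
  simp only [lt_iSup_iff] at h'
  obtain ⟨s, hs, h'⟩ := h'
  refine ⟨(ρ, s), ⟨hρ, hs⟩, ?_⟩
  have h2 := lt_exp_neg_of_lt_negLog h'
  simp only [letterBound, letterSum]
  refine (mul_lt_mul_of_pos_left h2 (Real.exp_pos _)).trans_eq ?_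
  rw [← Real.exp_add]
  congr 1
  ring

end ExponentForm

/-! ### Uniform convergence and the threshold decoder -/

section Uniformity

variable {R : ℝ}

lemma rate_mem_Icc (hR : 0 ≤ R) {N : ℕ} (W : Message N R) : rate W ∈ Set.Icc 0 R := by
  obtain ⟨h1, h2⟩ := Finset.mem_Icc.1 W.2
  have h1' : (1 : ℝ) ≤ W.1 := by exact_mod_cast h1
  rcases N.eq_zero_or_pos with rfl | hN
  · simpa [rate] using hR
  have hN' : (0 : ℝ) < N := Nat.cast_pos.2 hN
  refine ⟨mul_nonneg (by positivity) (Real.log_nonneg h1'), ?_⟩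
  rw [rate, one_div_mul_eq_div, div_le_iff₀ hN', Real.log_le_iff_le_exp (by linarith)]
  refine le_of_le_of_eq ?_ (congrArg Real.exp (mul_comm (N : ℝ) R))
  exact (Nat.le_floor_iff (Real.exp_pos _).le).1 h2

/-- Every rate in `[0, R]` is the limit of the rates of a sequence of messages. -/
lemma exists_tendsto_rate {r : ℝ} (hr : r ∈ Set.Icc 0 R) :
    ∃ V : ∀ N, Message N R, Tendsto (fun N => rate (V N)) atTop (𝓝 r) := by
  have hone : ∀ N : ℕ, 1 ≤ Real.exp (N * r) := fun N =>
    Real.one_le_exp (mul_nonneg (Nat.cast_nonneg N) hr.1)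
  refine ⟨fun N => ⟨⌊Real.exp (N * r)⌋₊, Finset.mem_Icc.2 ⟨Nat.le_floor (by simpa using hone N),
    Nat.floor_mono (Real.exp_le_exp.2 (mul_le_mul_of_nonneg_left hr.2 (Nat.cast_nonneg N)))⟩⟩, ?_⟩
  have hlow : Tendsto (fun N : ℕ => r - Real.log 2 * (1 / (N : ℝ))) atTop (𝓝 r) := by
    simpa using (tendsto_one_div_atTop_nhds_zero_nat.const_mul (Real.log 2)).const_sub r
  refine tendsto_of_tendsto_of_tendsto_of_le_of_le' hlow tendsto_const_nhds ?_ ?_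
  all_goals
    filter_upwards [eventually_gt_atTop 0] with N hN
    have hN' : (0 : ℝ) < N := Nat.cast_pos.2 hN
    have hfl : (1 : ℝ) ≤ ⌊Real.exp (N * r)⌋₊ := by
      exact_mod_cast Nat.le_floor (by simpa using hone N)
    simp only [rate]
  · have h2 : Real.exp (N * r) ≤ 2 * ⌊Real.exp (N * r)⌋₊ := by
      linarith [Nat.lt_floor_add_one (Real.exp (N * r))]
    have h3 := Real.log_le_log (Real.exp_pos _) h2
    rw [Real.log_exp, Real.log_mul (by norm_num) (by linarith)] at h3
    rw [← sub_nonneg]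
    have : 1 / (N : ℝ) * Real.log ⌊Real.exp (N * r)⌋₊ - (r - Real.log 2 * (1 / (N : ℝ))) =
        (Real.log 2 + Real.log ⌊Real.exp (N * r)⌋₊ - N * r) / N := by
      field_simp
      ring
    rw [this]
    exact div_nonneg (by linarith) hN'.le
  · rw [one_div_mul_eq_div, div_le_iff₀ hN', Real.log_le_iff_le_exp (by linarith), mul_comm r]
    exact Nat.floor_le (Real.exp_pos _).le

/-- The convergence to the asymptotic input distribution is uniform in the messages: messages
violating it for infinitely many lengths would have a subsequence with convergent rates, which
extends to a sequence of messages, one for each length, with convergent rates. -/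
lemma FollowsAsymptotic.eventually_abs_sub_le {𝒳 : Type v} [Fintype 𝒳] [MeasurableSpace 𝒳]
    (hR : 0 ≤ R) {𝓛 : ∀ N : ℕ, CodingScheme.{u} 𝒳 N R} {P : ℝ → 𝒳 → ℝ}
    (h : FollowsAsymptotic 𝓛 P) {ε : ℝ} (hε : 0 < ε) :
    ∀ᶠ N in atTop, ∀ (W : Message N R) x, |(𝓛 N).inputDist W x - P (rate W) x| ≤ ε := by
  classical
  by_contra hcon
  have hfreq : ∃ᶠ N in atTop, ∃ W : Message N R,
      ε < ‖(𝓛 N).inputDist W - P (rate W)‖ := by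
    refine (not_eventually.1 hcon).mono fun N hN => ?_
    push Not at hN
    obtain ⟨W, x, hx⟩ := hN
    exact ⟨W, hx.trans_le (norm_le_pi_norm ((𝓛 N).inputDist W - P (rate W)) x)⟩
  obtain ⟨V₀, -⟩ := exists_tendsto_rate (R := R) ⟨le_rfl, hR⟩
  -- a message of each length that violates the bound if any does
  have hw : ∀ N, ∃ w : Message N R, (∃ W : Message N R,
      ε < ‖(𝓛 N).inputDist W - P (rate W)‖) → ε < ‖(𝓛 N).inputDist w - P (rate w)‖ := by
    intro N
    by_cases hN : ∃ W : Message N R, ε < ‖(𝓛 N).inputDist W - P (rate W)‖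
    · obtain ⟨W, hW⟩ := hN
      exact ⟨W, fun _ => hW⟩
    · exact ⟨V₀ N, fun h => absurd h hN⟩
  choose w hw using hw
  obtain ⟨φ, hφ, hbad⟩ := extraction_of_frequently_atTop (hfreq.mono hw)
  obtain ⟨r₀, hr₀, ψ, hψ, hlim⟩ := isCompact_Icc.tendsto_subseq
    fun n => rate_mem_Icc hR (w (φ n))
  obtain ⟨V, hV⟩ := exists_tendsto_rate hr₀
  have hφψ : StrictMono (φ ∘ ψ) := hφ.comp hψ
  set U : ∀ N, Message N R := fun N => if N ∈ Set.range (φ ∘ ψ) then w N else V N with hU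
  have hUlim : Tendsto (fun N => rate (U N)) atTop (𝓝 r₀) := by
    rw [Metric.tendsto_atTop] at hlim hV ⊢
    intro η hη
    obtain ⟨n₀, hn₀⟩ := hlim η hη
    obtain ⟨N₀, hN₀⟩ := hV η hη
    refine ⟨max (φ (ψ n₀)) N₀, fun N hN => ?_⟩
    by_cases hmem : N ∈ Set.range (φ ∘ ψ)
    · simp only [hU, if_pos hmem]
      obtain ⟨n, rfl⟩ := hmem
      exact hn₀ n (hφψ.le_iff_le.1 ((le_max_left _ _).trans hN))
    · simp only [hU, if_neg hmem]
      exact hN₀ N ((le_max_right _ _).trans hN)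
  have hconv := ((h U r₀ hUlim).comp hφψ.tendsto_atTop).norm
  rw [norm_zero] at hconv
  obtain ⟨n, hn⟩ := (hconv.eventually_lt_const hε).exists
  have hmem : φ (ψ n) ∈ Set.range (φ ∘ ψ) := ⟨n, rfl⟩
  simp only [Function.comp_apply, hU, if_pos hmem] at hn
  exact (hbad (ψ n)).not_gt hn

end Uniformity

section Decoding

variable {K : ℕ} {𝒳 : Fin K → Type v} {𝒴 : Type w} {N : ℕ} {R : ℝ}
  [∀ k, Fintype (𝒳 k)] [∀ k, MeasurableSpace (𝒳 k)]

/-- Classes of message pairs, for each set of users: profiles that dominate those of the pairs,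
with the parameters `(ρ, s)` used for the class. -/
abbrev ClassFamily (𝒳 : Fin K → Type v) : Type v :=
  Finset (Fin K) → Finset (Profile 𝒳 × ℝ × ℝ)

/-- The likelihood of the codeword of `W` exceeds the threshold of every class that `W`
belongs to. -/
def Passes (𝓛 : ∀ k, CodingScheme.{u} (𝒳 k) N R) (ch : (∀ k, 𝒳 k) → 𝒴 → ℝ)
    (T : ClassFamily 𝒳) (c : ∀ k, Codebook (𝒳 k) N R) (y : Fin N → 𝒴)
    (W : Fin K → Message N R) : Prop :=
  ∀ S, ∀ t ∈ T S, (∀ k, rate (W k) ≤ t.1.1 k) → (∀ k x, dists 𝓛 W k x ≤ t.1.2.1 k x) →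
    threshold ch S t.1.1 t.1.2.1 t.1.2.2 t.2.1 t.2.2 (codeword c W) y <
      likelihood ch (codeword c W) y ^ (t.2.1 / (t.2.2 + t.2.1))

/-- `W` has rates in the region, passes the thresholds, and is strictly more likely than all other
message vectors with rates in the region. -/
def Decodable (𝓛 : ∀ k, CodingScheme.{u} (𝒳 k) N R) (ch : (∀ k, 𝒳 k) → 𝒴 → ℝ)
    (ℛ : Set (Fin K → ℝ)) (T : ClassFamily 𝒳) (c : ∀ k, Codebook (𝒳 k) N R) (y : Fin N → 𝒴)
    (W : Fin K → Message N R) : Prop :=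
  rateVec W ∈ ℛ ∧ Passes 𝓛 ch T c y W ∧ ∀ W', rateVec W' ∈ ℛ → W' ≠ W →
    likelihood ch (codeword c W') y < likelihood ch (codeword c W) y

open Classical in
/-- Maximum likelihood decoder over the region, reporting a collision unless the most likely
message vector is unique and passes the thresholds. -/
def thresholdDecoder (𝓛 : ∀ k, CodingScheme.{u} (𝒳 k) N R) (ch : (∀ k, 𝒳 k) → 𝒴 → ℝ)
    (ℛ : Set (Fin K → ℝ)) (T : ClassFamily 𝒳) : Decoder 𝒳 𝒴 N R := fun c y =>
  if h : ∃ W, Decodable 𝓛 ch ℛ T c y W then some h.choose else none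

lemma decodable_of_thresholdDecoder_eq {𝓛 : ∀ k, CodingScheme.{u} (𝒳 k) N R}
    {ch : (∀ k, 𝒳 k) → 𝒴 → ℝ} {ℛ : Set (Fin K → ℝ)} {T : ClassFamily 𝒳}
    {c : ∀ k, Codebook (𝒳 k) N R} {y : Fin N → 𝒴} {W : Fin K → Message N R}
    (h : thresholdDecoder 𝓛 ch ℛ T c y = some W) : Decodable 𝓛 ch ℛ T c y W := by
  unfold thresholdDecoder at h
  split_ifs at h with hex
  rw [← Option.some.inj h]
  exact hex.choose_spec

lemma Decodable.thresholdDecoder_eq {𝓛 : ∀ k, CodingScheme.{u} (𝒳 k) N R}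
    {ch : (∀ k, 𝒳 k) → 𝒴 → ℝ} {ℛ : Set (Fin K → ℝ)} {T : ClassFamily 𝒳}
    {c : ∀ k, Codebook (𝒳 k) N R} {y : Fin N → 𝒴} {W : Fin K → Message N R}
    (h : Decodable 𝓛 ch ℛ T c y W) : thresholdDecoder 𝓛 ch ℛ T c y = some W := by
  have hex : ∃ W, Decodable 𝓛 ch ℛ T c y W := ⟨W, h⟩
  unfold thresholdDecoder
  rw [dif_pos hex]
  congr 1
  by_contra hne
  have h' := hex.choose_spec
  exact lt_asymm (h.2.2 _ h'.1 hne) (h'.2.2 _ h.1 (Ne.symm hne))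

lemma agreeSet_ne_univ {W W' : Fin K → Message N R} (h : W ≠ W') :
    agreeSet W W' ≠ Finset.univ := fun he =>
  h (funext fun k => mem_agreeSet.1 (he ▸ Finset.mem_univ k))

variable [Fintype 𝒴]

lemma probGiven_and_le (𝓛 : ∀ k, CodingScheme.{u} (𝒳 k) N R) (ch : (∀ k, 𝒳 k) → 𝒴 → ℝ)
    (W : Fin K → Message N R) {p : Prop}
    {A : (∀ k, Codebook (𝒳 k) N R) → (Fin N → 𝒴) → Prop} {b : ℝ} (hb : 0 ≤ b)
    (h : p → probGiven 𝓛 ch W A ≤ b) : probGiven 𝓛 ch W (fun c y => p ∧ A c y) ≤ b := by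
  by_cases hp : p
  · simpa [hp] using h hp
  · simpa [hp, probGiven] using hb

variable [∀ k, MeasurableSingletonClass (𝒳 k)]

/-- System error probability of the threshold decoder, when the classes `T` cover the pairs of a
message vector in the region and one outside, and the classes `T'` cover the pairs in the
region. -/
lemma systemErrorProb_le (hN : 0 < N) (𝓛 : ∀ k, CodingScheme.{u} (𝒳 k) N R)
    {ch : (∀ k, 𝒳 k) → 𝒴 → ℝ} (hch : ∀ x, ch x ∈ stdSimplex ℝ 𝒴) (ℛ : Set (Fin K → ℝ))
    {b : ℝ} (hb : 0 ≤ b) (T T' : ClassFamily 𝒳)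
    (hT : ∀ S, ∀ t ∈ T S, t.2 ∈ paramsEi ∧ (∀ k x, 0 < t.1.2.1 k x) ∧
      (∀ k x, 0 < t.1.2.2 k x) ∧ letterBound ch S t.1 t.2.1 (t.2.2 / (t.2.2 + t.2.1))
        (t.2.2 + t.2.1) 1 (1 - t.2.2) < b)
    (hT' : ∀ S, ∀ t ∈ T' S, t.2 ∈ paramsEm ∧ (∀ k x, 0 < t.1.2.1 k x) ∧
      (∀ k x, 0 < t.1.2.2 k x) ∧
        letterBound ch S t.1 t.2.1 (1 - t.2.2) 1 (t.2.2 / t.2.1) t.2.1 < b)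
    (hcov : ∀ W V : Fin K → Message N R, rateVec W ∈ ℛ → rateVec V ∉ ℛ →
      ∃ t ∈ T (agreeSet V W), (∀ k, rate (W k) ≤ t.1.1 k) ∧
        (∀ k x, dists 𝓛 W k x ≤ t.1.2.1 k x) ∧ ∀ k x, dists 𝓛 V k x ≤ t.1.2.2 k x)
    (hcov' : ∀ W W' : Fin K → Message N R, W ≠ W' → rateVec W ∈ ℛ → rateVec W' ∈ ℛ →
      ∃ t ∈ T' (agreeSet W W'), (∀ k, rate (W' k) ≤ t.1.1 k) ∧
        (∀ k x, dists 𝓛 W k x ≤ t.1.2.1 k x) ∧ ∀ k x, dists 𝓛 W' k x ≤ t.1.2.2 k x) :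
    systemErrorProb 𝓛 ch ℛ (thresholdDecoder 𝓛 ch ℛ T) ≤
      ((Finset.univ.sigma T).card + (Finset.univ.sigma T').card) * b ^ N := by
  have hch0 : ∀ x y, 0 ≤ ch x y := fun x y => (hch x).1 y
  have hbN : 0 ≤ b ^ N := pow_nonneg hb N
  have htot : 0 ≤ (((Finset.univ.sigma T).card : ℝ) + (Finset.univ.sigma T').card) * b ^ N := by
    positivity
  refine max_le (Real.iSup_le ?_ htot) (Real.iSup_le ?_ htot)
  · rintro ⟨W, hW⟩
    rw [decodingErrorProb]
    refine (probGiven_le_sum 𝓛 hch0 W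
      ((Finset.univ.sigma T).disjSum (Finset.univ.sigma T'))
      (B := Sum.elim
        (fun i c y => (∀ k x, dists 𝓛 W k x ≤ i.2.1.2.1 k x) ∧
          likelihood ch (codeword c W) y ^ (i.2.2.1 / (i.2.2.2 + i.2.2.1)) ≤
            threshold ch i.1 i.2.1.1 i.2.1.2.1 i.2.1.2.2 i.2.2.1 i.2.2.2 (codeword c W) y)
        (fun i c y => (∀ k x, dists 𝓛 W k x ≤ i.2.1.2.1 k x) ∧
          ∃ W', agreeSet W W' = i.1 ∧ (∀ k, rate (W' k) ≤ i.2.1.1 k) ∧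
            (∀ k x, dists 𝓛 W' k x ≤ i.2.1.2.2 k x) ∧
            likelihood ch (codeword c W) y ≤ likelihood ch (codeword c W') y)) ?_).trans ?_
    · intro c y hD
      have hnot : ¬ Decodable 𝓛 ch ℛ T c y W := fun h => hD h.thresholdDecoder_eq
      by_cases hp : Passes 𝓛 ch T c y W
      · have : ∃ W', rateVec W' ∈ ℛ ∧ W' ≠ W ∧
            likelihood ch (codeword c W) y ≤ likelihood ch (codeword c W') y := by
          by_contra hcon
          push Not at hcon
          exact hnot ⟨hW, hp, hcon⟩
        obtain ⟨W', hW', hne, hle⟩ := this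
        obtain ⟨t, ht, h1, h2, h3⟩ := hcov' W W' hne.symm hW hW'
        exact ⟨Sum.inr ⟨_, t⟩, Finset.inr_mem_disjSum.2 (Finset.mem_sigma.2
          ⟨Finset.mem_univ _, ht⟩), h2, W', rfl, h1, h3, hle⟩
      · unfold Passes at hp
        push Not at hp
        obtain ⟨S, t, ht, h1, h2, h3⟩ := hp
        exact ⟨Sum.inl ⟨S, t⟩, Finset.inl_mem_disjSum.2 (Finset.mem_sigma.2
          ⟨Finset.mem_univ _, ht⟩), h2, h3⟩
    · rw [Finset.sum_disjSum, add_mul, ← nsmul_eq_mul, ← nsmul_eq_mul]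
      refine add_le_add (Finset.sum_le_card_nsmul _ _ _ ?_) (Finset.sum_le_card_nsmul _ _ _ ?_)
      · rintro ⟨S, t⟩ hi
        obtain ⟨hl, hP, hP', hlt⟩ := hT S t (Finset.mem_sigma.1 hi).2
        refine probGiven_and_le 𝓛 ch W hbN fun hWP => ?_
        exact (rejection_le 𝓛 hch0 W S t.1.1 hl.1.1 hl.2.1 hWP fun k x => (hP' k x).le).trans
          (pow_le_pow_left₀ (letterBound_nonneg hch0 S (fun k x => (hP k x).le)
            (fun k x => (hP' k x).le) _ _ _ _ _) hlt.le N)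
      · rintro ⟨S, t⟩ hi
        obtain ⟨hl, hP, hP', hlt⟩ := hT' S t (Finset.mem_sigma.1 hi).2
        refine probGiven_and_le 𝓛 ch W hbN fun hWP => ?_
        exact (confusion_le hN 𝓛 hch0 W S t.1.1 hl.1 hl.2 hWP fun k x => (hP' k x).le).trans
          (pow_le_pow_left₀ (letterBound_nonneg hch0 S (fun k x => (hP k x).le)
            (fun k x => (hP' k x).le) _ _ _ _ _) hlt.le N)
  · rintro ⟨V, hV⟩
    rw [missDetectionProb, ← probGiven_add_not 𝓛 hch V fun c y =>
      thresholdDecoder 𝓛 ch ℛ T c y = none, add_sub_cancel_left]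
    refine (probGiven_le_sum 𝓛 hch0 V (Finset.univ.sigma T)
      (B := fun i c y => ((∀ k ∈ i.1, ∀ x, dists 𝓛 V k x ≤ i.2.1.2.1 k x) ∧
          ∀ k x, dists 𝓛 V k x ≤ i.2.1.2.2 k x) ∧
        ∃ W, agreeSet V W = i.1 ∧ (∀ k, rate (W k) ≤ i.2.1.1 k) ∧
          (∀ k x, dists 𝓛 W k x ≤ i.2.1.2.1 k x) ∧
          threshold ch i.1 i.2.1.1 i.2.1.2.1 i.2.1.2.2 i.2.2.1 i.2.2.2 (codeword c W) y <
            likelihood ch (codeword c W) y ^ (i.2.2.1 / (i.2.2.2 + i.2.2.1))) ?_).trans ?_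
    · intro c y hD
      obtain ⟨W, hDW⟩ := Option.ne_none_iff_exists'.1 hD
      obtain ⟨hW, hp, -⟩ := decodable_of_thresholdDecoder_eq hDW
      obtain ⟨t, ht, h1, h2, h3⟩ := hcov W V hW hV
      refine ⟨⟨_, t⟩, Finset.mem_sigma.2 ⟨Finset.mem_univ _, ht⟩, ⟨fun k hk x => ?_, h3⟩, W, rfl,
        h1, h2, hp _ t ht h1 h2⟩
      have hVW : V k = W k := mem_agreeSet.1 hk
      simpa only [dists, hVW] using h2 k x
    · refine le_trans (Finset.sum_le_card_nsmul _ _ (b ^ N) ?_) ?_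
      · rintro ⟨S, t⟩ hi
        obtain ⟨hl, hP, hP', hlt⟩ := hT S t (Finset.mem_sigma.1 hi).2
        refine probGiven_and_le 𝓛 ch V hbN fun hVP => ?_
        exact (acceptance_le hN 𝓛 hch0 V S t.1.1 hl.1.1 hl.2 hVP.1 hVP.2 hP hP').trans
          (pow_le_pow_left₀ (letterBound_nonneg hch0 S (fun k x => (hP k x).le)
            (fun k x => (hP' k x).le) _ _ _ _ _) hlt.le N)
      · rw [nsmul_eq_mul, add_mul]
        exact le_add_of_nonneg_right (by positivity)

end Decoding

/-! ### Exponential decay of the system error probability -/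

section Asymptotics

variable {K : ℕ} {𝒳 : Fin K → Type v} {𝒴 : Type w} [∀ k, Fintype (𝒳 k)]

/-- Profiles of the pairs of rate vectors `r ∈ A`, `r' ∈ B` which agree on `S`. The function `q`
selects the rates that count: `r'` for `E_m` and `r` for `E_i`. -/
def profiles (P : ∀ k, ℝ → 𝒳 k → ℝ) (S : Finset (Fin K)) (A B : Set (Fin K → ℝ))
    (q : (Fin K → ℝ) → (Fin K → ℝ) → Fin K → ℝ) : Set (Profile 𝒳) :=
  {z | ∃ r ∈ A, ∃ r' ∈ B, (∀ k ∈ S, r k = r' k) ∧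
    z = (q r r', fun k => P k (r k), fun k => P k (r' k))}

variable {Rmax : ℝ} {P : ∀ k, ℝ → 𝒳 k → ℝ}

lemma profiles_nonneg (hP : ∀ k, ∀ r ∈ Set.Icc 0 Rmax, P k r ∈ stdSimplex ℝ (𝒳 k))
    {S : Finset (Fin K)} {A B : Set (Fin K → ℝ)} (hA : A ⊆ rateBox K Rmax)
    (hB : B ⊆ rateBox K Rmax) {q : (Fin K → ℝ) → (Fin K → ℝ) → Fin K → ℝ} {z : Profile 𝒳}
    (hz : z ∈ profiles P S A B q) : (∀ k x, 0 ≤ z.2.1 k x) ∧ ∀ k x, 0 ≤ z.2.2 k x := by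
  obtain ⟨r, hr, r', hr', -, rfl⟩ := hz
  exact ⟨fun k => (hP k _ (hA hr k)).1, fun k => (hP k _ (hB hr' k)).1⟩

lemma isBounded_profiles (hP : ∀ k, ∀ r ∈ Set.Icc 0 Rmax, P k r ∈ stdSimplex ℝ (𝒳 k))
    {S : Finset (Fin K)} {A B : Set (Fin K → ℝ)} (hA : A ⊆ rateBox K Rmax)
    (hB : B ⊆ rateBox K Rmax) {q : (Fin K → ℝ) → (Fin K → ℝ) → Fin K → ℝ}
    (hq : ∀ r ∈ A, ∀ r' ∈ B, q r r' ∈ rateBox K Rmax) :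
    Bornology.IsBounded (profiles P S A B q) := by
  refine (isCompact_Icc (a := ((fun _ => 0, fun _ _ => 0, fun _ _ => 0) : Profile 𝒳))
    (b := (fun _ => Rmax, fun _ _ => 1, fun _ _ => 1))).isBounded.subset ?_
  rintro z ⟨r, hr, r', hr', -, rfl⟩
  have h1 : ∀ k, ∀ r ∈ Set.Icc 0 Rmax, ∀ x, P k r x ≤ 1 := fun k r hr x =>
    (Finset.single_le_sum (fun x _ => (hP k r hr).1 x) (Finset.mem_univ x)).trans_eq (hP k r hr).2
  exact ⟨⟨fun k => (hq r hr r' hr' k).1, fun k => (hP k _ (hA hr k)).1,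
    fun k => (hP k _ (hB hr' k)).1⟩, fun k => (hq r hr r' hr' k).2, fun k => h1 k _ (hA hr k),
    fun k => h1 k _ (hB hr' k)⟩

variable [Fintype 𝒴]

/-- A decoder with the smallest system error probability. -/
lemma exists_optimal_decoder [∀ k, MeasurableSpace (𝒳 k)] {N : ℕ}
    (𝓛 : ∀ k, CodingScheme.{u} (𝒳 k) N Rmax)
    (ch : (∀ k, 𝒳 k) → 𝒴 → ℝ) (ℛ : Set (Fin K → ℝ)) :
    ∃ D : Decoder 𝒳 𝒴 N Rmax, D.OutputsIn ℛ ∧ ∀ D' : Decoder 𝒳 𝒴 N Rmax, D'.OutputsIn ℛ →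
      systemErrorProb 𝓛 ch ℛ D ≤ systemErrorProb 𝓛 ch ℛ D' := by
  have : Nonempty {D : Decoder 𝒳 𝒴 N Rmax // D.OutputsIn ℛ} :=
    ⟨⟨fun _ _ => none, fun _ _ _ h => by simp at h⟩⟩
  have : Finite (Decoder 𝒳 𝒴 N Rmax) := by unfold Decoder; infer_instance
  obtain ⟨D, hD⟩ := Finite.exists_min fun D : {D : Decoder 𝒳 𝒴 N Rmax // D.OutputsIn ℛ} =>
    systemErrorProb 𝓛 ch ℛ D.1
  exact ⟨D.1, D.2, fun D' hD' => hD ⟨D', hD'⟩⟩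

lemma le_neg_inv_mul_log {N : ℕ} (hN : 0 < N) {b p : ℝ} (h : p ≤ Real.exp (-b) ^ N) :
    (b : EReal) ≤ ((-(1 / (N : ℝ)) : ℝ) : EReal) * ENNReal.log (ENNReal.ofReal p) := by
  have hN' : (0 : ℝ) < N := Nat.cast_pos.2 hN
  rcases le_or_gt p 0 with hp | hp
  · rw [ENNReal.ofReal_of_nonpos hp, ENNReal.log_zero,
      EReal.coe_mul_bot_of_neg (by simpa using hN)]
    exact le_top
  · rw [ENNReal.log_ofReal_of_pos hp, ← EReal.coe_mul, EReal.coe_le_coe_iff]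
    rw [← Real.exp_nat_mul, ← Real.log_le_iff_le_exp hp] at h
    rw [neg_mul, one_div_mul_eq_div, ← neg_div, le_div_iff₀ hN']
    linarith

/-- For every real number less than the exponent bound there are decoders whose system error
probability decays with that exponent, up to a constant factor. -/
lemma eventually_exists_decoder [∀ k, MeasurableSpace (𝒳 k)]
    [∀ k, MeasurableSingletonClass (𝒳 k)] {ch : (∀ k, 𝒳 k) → 𝒴 → ℝ}
    (hch : ∀ x, ch x ∈ stdSimplex ℝ 𝒴) (hRmax : 0 ≤ Rmax)
    (𝓛 : ∀ (N : ℕ) (k : Fin K), CodingScheme.{u} (𝒳 k) N Rmax)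
    (hP : ∀ k, ∀ r ∈ Set.Icc 0 Rmax, P k r ∈ stdSimplex ℝ (𝒳 k))
    (hasymp : ∀ k, FollowsAsymptotic (fun N => 𝓛 N k) (P k))
    {ℛ : Set (Fin K → ℝ)} (hℛ : ℛ ⊆ rateBox K Rmax) {b b' : ℝ}
    (hb : (b : EReal) < exponentBound ch P Rmax ℛ) (hb' : b' < b) :
    ∃ M : ℝ, ∀ᶠ N in atTop, ∃ D : Decoder 𝒳 𝒴 N Rmax, D.OutputsIn ℛ ∧
      systemErrorProb (𝓛 N) ch ℛ D ≤ M * Real.exp (-b') ^ N := by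
  have hch0 : ∀ x y, 0 ≤ ch x y := fun x y => (hch x).1 y
  have hexp : Real.exp (-b) < Real.exp (-b') := Real.exp_lt_exp.2 (by linarith)
  have hbox : rateBox K Rmax \ ℛ ⊆ rateBox K Rmax := Set.sdiff_subset
  have hbm : ∀ S : Finset (Fin K), S ⊂ Finset.univ → ∀ r ∈ ℛ, ∀ r' ∈ ℛ, (∀ k ∈ S, r k = r' k) →
      (b : EReal) < Em ch S r' (fun k => P k (r k)) (fun k => P k (r' k)) := by
    intro S hS r hr r' hr' h
    refine (hb.trans_le (min_le_left _ _)).trans_le ?_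
    exact (iInf₂_le S hS).trans ((iInf₂_le r hr).trans ((iInf₂_le r' hr').trans (iInf_le _ h)))
  have hbi : ∀ S : Finset (Fin K), S ⊂ Finset.univ → ∀ r ∈ ℛ, ∀ r' ∈ rateBox K Rmax \ ℛ,
      (∀ k ∈ S, r k = r' k) → (b : EReal) < Ei ch S r (fun k => P k (r k)) (fun k => P k (r' k)) := by
    intro S hS r hr r' hr' h
    refine (hb.trans_le (min_le_right _ _)).trans_le ?_
    exact (iInf₂_le S hS).trans ((iInf₂_le r hr).trans ((iInf₂_le r' hr').trans (iInf_le _ h)))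
  have hm : ∀ S : Finset (Fin K), ∃ ε > 0, ∃ T : Finset (Profile 𝒳 × ℝ × ℝ),
      (∀ t ∈ T, t.2 ∈ paramsEm ∧ (∀ k x, 0 < t.1.2.1 k x) ∧ (∀ k x, 0 < t.1.2.2 k x) ∧
        letterBound ch S t.1 t.2.1 (1 - t.2.2) 1 (t.2.2 / t.2.1) t.2.1 < Real.exp (-b')) ∧
      (S ⊂ Finset.univ → ∀ z ∈ profiles P S ℛ ℛ fun _ r' => r', ∃ t ∈ T, z.raise ε ≤ t.1) := by
    intro S
    by_cases hS : S ⊂ Finset.univ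
    · obtain ⟨ε, hε, T, hT, hcov⟩ := exists_finite_cover hch0 S paramsEm (fun l => l.1)
        (fun l => 1 - l.2) (fun _ => 1) (fun l => l.2 / l.1) (fun l => l.1) (fun l hl => hl.1)
        (fun _ _ => ⟨one_pos, le_rfl⟩) (fun l hl => hl.1)
        (isBounded_profiles (S := S) hP hℛ hℛ (q := fun _ r' => r') fun _ _ r' hr' => hℛ hr')
        (fun z hz => profiles_nonneg hP hℛ hℛ hz) hexp
        (by
          rintro z ⟨r, hr, r', hr', h, rfl⟩
          exact exists_letterBound_lt_of_lt_Em (hbm S hS r hr r' hr' h))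
      exact ⟨ε, hε, T, hT, fun _ => hcov⟩
    · exact ⟨1, one_pos, ∅, by simp, fun h => absurd h hS⟩
  have hi : ∀ S : Finset (Fin K), ∃ ε > 0, ∃ T : Finset (Profile 𝒳 × ℝ × ℝ),
      (∀ t ∈ T, t.2 ∈ paramsEi ∧ (∀ k x, 0 < t.1.2.1 k x) ∧ (∀ k x, 0 < t.1.2.2 k x) ∧
        letterBound ch S t.1 t.2.1 (t.2.2 / (t.2.2 + t.2.1)) (t.2.2 + t.2.1) 1 (1 - t.2.2) <
          Real.exp (-b')) ∧
      (S ⊂ Finset.univ → ∀ z ∈ profiles P S ℛ (rateBox K Rmax \ ℛ) fun r _ => r,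
        ∃ t ∈ T, z.raise ε ≤ t.1) := by
    intro S
    by_cases hS : S ⊂ Finset.univ
    · obtain ⟨ε, hε, T, hT, hcov⟩ := exists_finite_cover hch0 S paramsEi (fun l => l.1)
        (fun l => l.2 / (l.2 + l.1)) (fun l => l.2 + l.1) (fun _ => 1) (fun l => 1 - l.2)
        (fun l hl => hl.1) (fun l hl => ⟨by linarith [hl.1.1, hl.2.1], by linarith [hl.2.2]⟩)
        (fun l hl => ⟨by linarith [hl.1.1, hl.2.2], by linarith [hl.2.1]⟩)
        (isBounded_profiles (S := S) hP hℛ hbox (q := fun r _ => r) fun r hr _ _ => hℛ hr)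
        (fun z hz => profiles_nonneg hP hℛ hbox hz) hexp
        (by
          rintro z ⟨r, hr, r', hr', h, rfl⟩
          exact exists_letterBound_lt_of_lt_Ei (hbi S hS r hr r' hr' h))
      exact ⟨ε, hε, T, hT, fun _ => hcov⟩
    · exact ⟨1, one_pos, ∅, by simp, fun h => absurd h hS⟩
  choose εm hεm Tm hTm hcovm using hm
  choose εi hεi Ti hTi hcovi using hi
  refine ⟨(Finset.univ.sigma Ti).card + (Finset.univ.sigma Tm).card, ?_⟩
  have hconv : ∀ᶠ N in atTop, ∀ S k, ∀ (W : Message N Rmax) x,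
      |(𝓛 N k).inputDist W x - P k (rate W) x| ≤ min (εm S) (εi S) :=
    eventually_all.2 fun S => eventually_all.2 fun k =>
      (hasymp k).eventually_abs_sub_le hRmax (lt_min (hεm S) (hεi S))
  filter_upwards [hconv, eventually_gt_atTop 0] with N hN hNpos
  have hrate : ∀ W : Fin K → Message N Rmax, rateVec W ∈ rateBox K Rmax := fun W k =>
    rate_mem_Icc hRmax (W k)
  have hdm : ∀ S (W : Fin K → Message N Rmax) k x,
      dists (𝓛 N) W k x ≤ P k (rateVec W k) x + εm S := fun S W k x => by
    have := (abs_le.1 (hN S k (W k) x)).2.trans (min_le_left _ _)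
    simp only [dists, rateVec]
    linarith
  have hdi : ∀ S (W : Fin K → Message N Rmax) k x,
      dists (𝓛 N) W k x ≤ P k (rateVec W k) x + εi S := fun S W k x => by
    have := (abs_le.1 (hN S k (W k) x)).2.trans (min_le_right _ _)
    simp only [dists, rateVec]
    linarith
  refine ⟨thresholdDecoder (𝓛 N) ch ℛ Ti, fun c y W h => (decodable_of_thresholdDecoder_eq h).1,
    systemErrorProb_le hNpos (𝓛 N) hch ℛ (Real.exp_pos _).le Ti Tm hTi hTm ?_ ?_⟩
  · intro W V hW hV
    have hne : V ≠ W := fun h => hV (h ▸ hW)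
    have hS := Finset.ssubset_univ_iff.2 (agreeSet_ne_univ hne)
    obtain ⟨t, ht, h1, h2, h3⟩ := hcovi _ hS
      (rateVec W, fun k => P k (rateVec W k), fun k => P k (rateVec V k))
      ⟨rateVec W, hW, rateVec V, ⟨hrate V, hV⟩,
        fun k hk => congrArg rate (mem_agreeSet.1 hk).symm, rfl⟩
    refine ⟨t, ht, fun k => ?_, fun k x => (hdi _ W k x).trans (h2 k x),
      fun k x => (hdi _ V k x).trans (h3 k x)⟩
    exact (le_add_of_nonneg_right (hεi _).le).trans (h1 k)
  · intro W W' hne hW hW'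
    have hS := Finset.ssubset_univ_iff.2 (agreeSet_ne_univ hne)
    obtain ⟨t, ht, h1, h2, h3⟩ := hcovm _ hS
      (rateVec W', fun k => P k (rateVec W k), fun k => P k (rateVec W' k))
      ⟨rateVec W, hW, rateVec W', hW',
        fun k hk => congrArg rate (mem_agreeSet.1 hk), rfl⟩
    refine ⟨t, ht, fun k => ?_, fun k x => (hdm _ W k x).trans (h2 k x),
      fun k x => (hdm _ W' k x).trans (h3 k x)⟩
    exact (le_add_of_nonneg_right (hεm _).le).trans (h1 k)

end Asymptotics

end RandomAccess

end

theorem theorem3 {K : ℕ} {𝒳 : Fin K → Type v} {𝒴 : Type w}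
    [∀ k, Fintype (𝒳 k)] [∀ k, MeasurableSpace (𝒳 k)] [∀ k, MeasurableSingletonClass (𝒳 k)]
    [Fintype 𝒴]
    -- the discrete memoryless channel
    (ch : (∀ k, 𝒳 k) → 𝒴 → ℝ) (hch : ∀ x, ch x ∈ stdSimplex ℝ 𝒴)
    -- the coding schemes of the users and their asymptotic input distributions
    (Rmax : ℝ) (hRmax : 0 < Rmax)
    (𝓛 : ∀ (N : ℕ) (k : Fin K), RandomAccess.CodingScheme.{u} (𝒳 k) N Rmax)
    (P : ∀ k, ℝ → 𝒳 k → ℝ)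
    (hP : ∀ k, ∀ r ∈ Set.Icc 0 Rmax, P k r ∈ stdSimplex ℝ (𝒳 k))
    (hasymp : ∀ k, RandomAccess.FollowsAsymptotic (fun N => 𝓛 N k) (P k))
    (hdisc : ∀ k, {r ∈ Set.Icc 0 Rmax |
      ¬ ContinuousWithinAt (P k) (Set.Icc 0 Rmax) r}.Finite)
    -- the operation region
    (ℛ : Set (Fin K → ℝ)) (hℛ : ℛ ⊆ RandomAccess.rateBox K Rmax) :
    ∃ D : ∀ N : ℕ, RandomAccess.Decoder 𝒳 𝒴 N Rmax,
      (∀ N, (D N).OutputsIn ℛ) ∧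
      RandomAccess.exponentBound ch P Rmax ℛ ≤
        RandomAccess.systemErrorExponent 𝓛 ch ℛ D := by
  choose D hD hopt using fun N => RandomAccess.exists_optimal_decoder (𝓛 N) ch ℛ
  refine ⟨D, hD, le_of_forall_lt fun e he => ?_⟩
  obtain ⟨b, heb, hb⟩ := EReal.lt_iff_exists_real_btwn.1 he
  obtain ⟨b₂, heb₂, hb₂⟩ := EReal.lt_iff_exists_real_btwn.1 heb
  rw [EReal.coe_lt_coe_iff] at hb₂
  obtain ⟨b₁, hb₂₁, hb₁⟩ := exists_between hb₂
  obtain ⟨M, hM⟩ := RandomAccess.eventually_exists_decoder hch hRmax.le 𝓛 hP hasymp hℛ hb hb₁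
  refine heb₂.trans_le (le_liminf_of_le (h := ?_))
  -- the constant factor is absorbed by the gap between `b₂` and `b₁`
  have hlim : Tendsto (fun N : ℕ => M * Real.exp (-(b₁ - b₂)) ^ N) atTop (𝓝 (M * 0)) :=
    (tendsto_pow_atTop_nhds_zero_of_lt_one (Real.exp_pos _).le
      (Real.exp_lt_one_iff.2 (by linarith))).const_mul M
  rw [mul_zero] at hlim
  filter_upwards [hM, hlim.eventually_lt_const one_pos, eventually_gt_atTop 0] with N hN hN1 hNpos
  obtain ⟨D', hD', hle⟩ := hN
  refine RandomAccess.le_neg_inv_mul_log hNpos (((hopt N D' hD').trans hle).trans ?_)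
  calc M * Real.exp (-b₁) ^ N
      = M * Real.exp (-(b₁ - b₂)) ^ N * Real.exp (-b₂) ^ N := by
        rw [mul_assoc, ← mul_pow, ← Real.exp_add]
        congr 3
        ring
    _ ≤ 1 * Real.exp (-b₂) ^ N :=
        mul_le_mul_of_nonneg_right hN1.le (pow_nonneg (Real.exp_pos _).le N)
    _ = Real.exp (-b₂) ^ N := one_mul _
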